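/- Let $R$ be a commutative Noetherian local ring of Krull dimension $d$; all modules below are finitely generated, and $M^{\ast}=\operatorname{Hom}_R(M,R)$. A module $X$ is \emph{totally reflexive} if the canonical map $X\to X^{\ast\ast}$ is an isomorphism and $\operatorname{Ext}^i_R(X,R)=0=\operatorname{Ext}^i_R(X^{\ast},R)$ for all $i\ge 1$. The \emph{Gorenstein dimension} $\operatorname{G-dim}_R(M)$ of a nonzero module $M$ is the infimum of the $n\ge 0$ for which there is an exact sequence $0\to X_n\to\cdots\to X_0\to M\to 0$ with all $X_i$ totally reflexive ($\infty$ if there is none), and $\operatorname{G-dim}_R(0)=-\infty$. Write $\Omega^n M$ for the $n$-th syzygy of $M$ in its minimal free resolution. Let $\mathsf{H}$ be either projective dimension $\operatorname{pd}_R$ or Gorenstein dimension $\operatorname{G-dim}_R$. A \emph{reducing $\mathsf{H}$-sequence} of $M$ is a sequence of modules $K_0,\ldots,K_r$ ($r\ge 0$) with $K_0=M$ and $\mathsf{H}(K_r)<\infty$ such that for each $i=1,\ldots,r$ there are positive integers $a_i,b_i,n_i$ and a short exact sequence $$0\to K_{i-1}^{\oplus a_i}\to K_i\to (\Omega^{n_i}K_{i-1})^{\oplus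 b_i}\to 0.$$ The \emph{reducing projective dimension} $\operatorname{red-pd}_R(M)$ (for $\mathsf{H}=\operatorname{pd}_R$) and the \emph{reducing Gorenstein dimension} $\operatorname{red-G-dim}_R(M)$ (for $\mathsf{H}=\operatorname{G-dim}_R$) are the infimum of the $r$ for which $M$ has a reducing $\mathsf{H}$-sequence $K_0,\ldots,K_r$ ($\infty$ if there is none). Theorem. Let $M$ be a nonzero finitely generated $R$-module of finite injective dimension. Then: (i) $\operatorname{red-G-dim}_R(M)=\operatorname{red-pd}_R(M)$. (ii) If $\operatorname{red-G-dim}_R(M)\le 1$, or if $\operatorname{red-G-dim}_R(M)<\infty$ and $\operatorname{depth}_R(M)\ge d-1$, then $R$ is Gorenstein. -/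

import Mathlib

universe u

namespace ReducingDimension

open CategoryTheory

/-- A commutative Noetherian local ring `R` is Gorenstein when it has finite injective dimension
as a module over itself. -/
def IsGorenstein (R : Type u) [CommRing R] [IsLocalRing R] [IsNoetherianRing R] : Prop :=
  injectiveDimension (ModuleCat.of R R) < ⊤

/-- The depth of a module over a local ring: the supremum of the lengths of the `M`-regular
sequences contained in the maximal ideal. -/
noncomputable def depth (R : Type u) [CommRing R] [IsLocalRing R]
    (M : Type u) [AddCommGroup M] [Module R M] : ℕ∞ :=
  ⨆ (rs : List R) (_ : RingTheory.Sequence.IsRegular M rs)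
    (_ : ∀ x ∈ rs, x ∈ IsLocalRing.maximalIdeal R), (rs.length : ℕ∞)

section

variable {R : Type u} [CommRing R]

/-- Totally reflexive modules: finitely generated, the canonical map from `M` to its double dual
is bijective, and `Ext^i(M, R) = 0 = Ext^i(M^*, R)` for all `i ≥ 1`. -/
structure IsTotallyReflexive (M : ModuleCat.{u} R) : Prop where
  finite : Module.Finite R M
  reflexive : Module.IsReflexive R M
  ext_self : ∀ i : ℕ, 1 ≤ i → Subsingleton (Abelian.Ext M (ModuleCat.of R R) i)
  ext_dual : ∀ i : ℕ, 1 ≤ i →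
    Subsingleton (Abelian.Ext (ModuleCat.of R (Module.Dual R M)) (ModuleCat.of R R) i)

/-- `HasTotallyReflexiveResolution M n` says that there is an exact sequence
`0 → X_n → ⋯ → X_0 → M → 0` with all `X_i` totally reflexive. It is built from the short exact
sequences `0 → K → X_0 → M → 0` into which such a sequence decomposes. -/
inductive HasTotallyReflexiveResolution : ModuleCat.{u} R → ℕ → Prop
  | zero (M : ModuleCat.{u} R) (hM : IsTotallyReflexive M) : HasTotallyReflexiveResolution M 0
  | succ (K X M : ModuleCat.{u} R) (n : ℕ) (f : K →ₗ[R] X) (g : X →ₗ[R] M)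
      (hf : Function.Injective f) (hfg : Function.Exact f g) (hg : Function.Surjective g)
      (hX : IsTotallyReflexive X) (hK : HasTotallyReflexiveResolution K n) :
      HasTotallyReflexiveResolution M (n + 1)

open Classical in
/-- The Gorenstein dimension (G-dimension), with value `⊥` (that is, `-∞`) at the zero module
and value `⊤` if there is no finite resolution by totally reflexive modules. -/
noncomputable def gDim (M : ModuleCat.{u} R) : WithBot ℕ∞ :=
  if Subsingleton M then ⊥
  else ((⨅ (n : ℕ) (_ : HasTotallyReflexiveResolution M n), (n : ℕ∞) : ℕ∞) : WithBot ℕ∞)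

/-- The first syzygy `Ω M` of a finitely generated module over a local ring: the kernel of the
surjection `F → M` given by a generating set of `M` of least cardinality, with `F` free on it.
Over a local ring this is the kernel of a free cover, and is unique up to isomorphism. -/
noncomputable def syzygy (M : ModuleCat.{u} R) : ModuleCat.{u} R :=
  ModuleCat.of R (LinearMap.ker (Finsupp.linearCombination R
    (Subtype.val : ((⊤ : Submodule R M).generators : Set M) → M)))

/-- The `n`-th syzygy `Ω^n M`, taken from a minimal free resolution of `M`. -/
noncomputable def syzygyPow (n : ℕ) (M : ModuleCat.{u} R) : ModuleCat.{u} R :=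
  syzygy^[n] M

/-- `K_0, …, K_r` is a reducing `H`-sequence of `M`, for a homological invariant `H`: all `K_i` are
finitely generated, `K_0 = M`, `H(K_r) < ∞`, and for each `1 ≤ i ≤ r` there are positive integers
`a, b, n` and a short exact sequence `0 → K_{i-1}^a → K_i → (Ω^n K_{i-1})^b → 0`. -/
structure IsReducingSequence (H : ModuleCat.{u} R → WithBot ℕ∞) (M : ModuleCat.{u} R) (r : ℕ)
    (K : Fin (r + 1) → ModuleCat.{u} R) : Prop where
  finite : ∀ i, Module.Finite R (K i)
  zero : K 0 = M
  last : H (K (Fin.last r)) < ⊤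
  step : ∀ i : Fin r, ∃ a b n : ℕ, 0 < a ∧ 0 < b ∧ 0 < n ∧
    ∃ (f : (Fin a → K i.castSucc) →ₗ[R] K i.succ)
      (g : K i.succ →ₗ[R] (Fin b → syzygyPow n (K i.castSucc))),
      Function.Injective f ∧ Function.Exact f g ∧ Function.Surjective g

/-- The reducing invariant of `H`: the infimum of the `r` for which `M` has a reducing
`H`-sequence `K_0, …, K_r` (it is `⊤` if there is none). -/
noncomputable def reducingDim (H : ModuleCat.{u} R → WithBot ℕ∞) (M : ModuleCat.{u} R) : ℕ∞ :=
  ⨅ (r : ℕ) (_ : ∃ K : Fin (r + 1) → ModuleCat.{u} R, IsReducingSequence H M r K), (r : ℕ∞)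

/-- The reducing projective dimension. -/
noncomputable def reducingProjDim (M : ModuleCat.{u} R) : ℕ∞ :=
  reducingDim (fun N : ModuleCat.{u} R => projectiveDimension N) M

/-- The reducing Gorenstein dimension. -/
noncomputable def reducingGDim (M : ModuleCat.{u} R) : ℕ∞ :=
  reducingDim (fun N : ModuleCat.{u} R => gDim N) M

end

end ReducingDimension

/-!
Part (i) rests on an orthogonality. A totally reflexive module `X` has cosyzygies that are totally
reflexive again, so `Ext^i(X, N) = 0` for all `i ≥ 1` whenever `N` has finite injective dimension.
The modules `N` orthogonal in this sense to all totally reflexive modules are closed under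
extensions and syzygies (`IsTROrthogonal`), and therefore include every term of a reducing sequence
of `M`. A finitely generated module of this kind that has finite G-dimension has finite projective
dimension, because a totally reflexive one is a direct summand of a free module. Reducing sequences
for the two dimensions are thus the same.

Part (ii) is reduced to a statement on complexes. Let `P` be a nonzero bounded complex of finitely
generated free modules whose differential has entries in the maximal ideal, and suppose that all its
homology modules have finite injective dimension. Then `R` is Gorenstein
(`MinimalComplex.isGorenstein_of_homologyFiniteInjDim`). To see this, let `I` be an injective
resolution of `R`. The total complex of `P ⊗ I` consists of injective modules and has the homology
of `P`, so its cocycle modules have finite injective dimension. Since it is moreover exact in high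
degrees, it remains exact there after applying `Hom(k, -)`, where `k` is the residue field. But the
differential of `P` vanishes on socles, and `Hom(k, P ⊗ I)` is a direct sum of shifted copies of
`Hom(k, I)`. Hence `Ext^i(k, R) = 0` for all large `i`.

If `M` has finite projective dimension, `P` is its minimal free resolution. For a reducing sequence
`M, K` of length one, with `0 → M^a → K → (Ω^n M)^b → 0` and `K` of finite projective dimension, the
minimal free resolution of `K` is followed by the composite `K → (Ω^n M)^b → F_{n-1}` and by the
remainder of the minimal free resolution `F` of `M^b`. The homology of the resulting complex is
`M^b` in degree zero and `M^a` in degree `n` (`HasMinimalModel.splice`).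

If `depth M ≥ dim R - 1`, a regular sequence on `M` and the bound `inj.dim M ≤ dim R` show that
`Ext^j(M, M) = 0` for `j ≥ 2`. All obstructions to extending `K_{i-1} → M` to `K_i` along a reducing
sequence then vanish, and `M` is a direct summand of the last term of the sequence
(`IsReducingSequence.exists_retract`). It has finite projective dimension, which is the case
already treated.
-/

namespace ReducingDimension

open CategoryTheory Abelian

/-! ### Vanishing of Ext and homological dimensions in short exact sequences -/

section ExtToolkit

variable {R : Type u} [CommRing R]

lemma shortExact_mk {A B C : ModuleCat.{u} R} {f : A →ₗ[R] B} {g : B →ₗ[R] C}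
    (hf : Function.Injective f) (hfg : Function.Exact f g) (hg : Function.Surjective g) :
    (ShortComplex.mk (ModuleCat.ofHom f) (ModuleCat.ofHom g)
      (by ext x; exact hfg.apply_apply_eq_zero x)).ShortExact :=
  ModuleCat.shortComplex_shortExact _ hfg hf hg

variable {A B C : ModuleCat.{u} R} {f : A →ₗ[R] B} {g : B →ₗ[R] C}
  (hf : Function.Injective f) (hfg : Function.Exact f g) (hg : Function.Surjective g)

section
include hf hfg hg

lemma ext_covariant_mid {X : ModuleCat.{u} R} {n : ℕ} (hA : Subsingleton (Ext X A n))
    (hC : Subsingleton (Ext X C n)) : Subsingleton (Ext X B n) := by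
  refine subsingleton_of_forall_eq 0 fun x => ?_
  obtain ⟨y, rfl⟩ := Ext.covariant_sequence_exact₂ X (shortExact_mk hf hfg hg) x
    (Subsingleton.elim (h := hC) _ _)
  rw [Subsingleton.elim (h := hA) y 0, Ext.zero_comp]

lemma ext_covariant_left {X : ModuleCat.{u} R} {n : ℕ} (hC : Subsingleton (Ext X C n))
    (hB : Subsingleton (Ext X B (n + 1))) : Subsingleton (Ext X A (n + 1)) := by
  refine subsingleton_of_forall_eq 0 fun x => ?_
  obtain ⟨y, rfl⟩ := Ext.covariant_sequence_exact₁ X (shortExact_mk hf hfg hg) x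
    (Subsingleton.elim (h := hB) _ _) rfl
  rw [Subsingleton.elim (h := hC) y 0, Ext.zero_comp]

lemma ext_covariant_right {X : ModuleCat.{u} R} {n : ℕ} (hB : Subsingleton (Ext X B n))
    (hA : Subsingleton (Ext X A (n + 1))) : Subsingleton (Ext X C n) := by
  refine subsingleton_of_forall_eq 0 fun x => ?_
  obtain ⟨y, rfl⟩ := Ext.covariant_sequence_exact₃ X (shortExact_mk hf hfg hg) x rfl
    (Subsingleton.elim (h := hA) _ _)
  rw [Subsingleton.elim (h := hB) y 0, Ext.zero_comp]

lemma ext_contravariant_mid {Y : ModuleCat.{u} R} {n : ℕ} (hA : Subsingleton (Ext A Y n))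
    (hC : Subsingleton (Ext C Y n)) : Subsingleton (Ext B Y n) := by
  refine subsingleton_of_forall_eq 0 fun x => ?_
  obtain ⟨y, rfl⟩ := Ext.contravariant_sequence_exact₂ (shortExact_mk hf hfg hg) Y x
    (Subsingleton.elim (h := hA) _ _)
  rw [Subsingleton.elim (h := hC) y 0, Ext.comp_zero]

lemma ext_contravariant_left {Y : ModuleCat.{u} R} {n : ℕ} (hB : Subsingleton (Ext B Y n))
    (hC : Subsingleton (Ext C Y (n + 1))) : Subsingleton (Ext A Y n) := by
  refine subsingleton_of_forall_eq 0 fun x => ?_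
  obtain ⟨y, rfl⟩ := Ext.contravariant_sequence_exact₁ (shortExact_mk hf hfg hg) Y x
    (add_comm 1 n) (Subsingleton.elim (h := hC) _ _)
  rw [Subsingleton.elim (h := hB) y 0, Ext.comp_zero]

lemma ext_contravariant_right {Y : ModuleCat.{u} R} {n : ℕ} (hA : Subsingleton (Ext A Y n))
    (hB : Subsingleton (Ext B Y (n + 1))) : Subsingleton (Ext C Y (n + 1)) := by
  refine subsingleton_of_forall_eq 0 fun x => ?_
  obtain ⟨y, rfl⟩ := Ext.contravariant_sequence_exact₃ (shortExact_mk hf hfg hg) Y x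
    (Subsingleton.elim (h := hB) _ _) (add_comm 1 n)
  rw [Subsingleton.elim (h := hA) y 0, Ext.comp_zero]

lemma exists_extension_of_ext_one {Y : ModuleCat.{u} R} (hC : Subsingleton (Ext C Y 1))
    (φ : A →ₗ[R] Y) : ∃ ψ : B →ₗ[R] Y, ψ ∘ₗ f = φ := by
  obtain ⟨y, hy⟩ := Ext.contravariant_sequence_exact₁ (shortExact_mk hf hfg hg) Y
    (Ext.mk₀ (ModuleCat.ofHom φ)) (add_comm 1 0) (Subsingleton.elim (h := hC) _ _)
  obtain ⟨ψ, rfl⟩ := Ext.homEquiv₀.symm.surjective y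
  refine ⟨ψ.hom, ?_⟩
  have : ModuleCat.ofHom f ≫ ψ = ModuleCat.ofHom φ :=
    Ext.homEquiv₀.symm.injective (by simpa using hy)
  simpa using congrArg ModuleCat.Hom.hom this

lemma exists_lift_of_ext_one {X : ModuleCat.{u} R} (hA : Subsingleton (Ext X A 1))
    (φ : X →ₗ[R] C) : ∃ ψ : X →ₗ[R] B, g ∘ₗ ψ = φ := by
  obtain ⟨y, hy⟩ := Ext.covariant_sequence_exact₃ X (shortExact_mk hf hfg hg)
    (Ext.mk₀ (ModuleCat.ofHom φ)) (zero_add 1) (Subsingleton.elim (h := hA) _ _)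
  obtain ⟨ψ, rfl⟩ := Ext.homEquiv₀.symm.surjective y
  refine ⟨ψ.hom, ?_⟩
  have : ψ ≫ ModuleCat.ofHom g = ModuleCat.ofHom φ :=
    Ext.homEquiv₀.symm.injective (by simpa using hy)
  simpa using congrArg ModuleCat.Hom.hom this

/-- If all maps `X → C` lift to `B` and `Ext¹(X, B) = 0`, then `Ext¹(X, A) = 0`. -/
lemma ext_one_of_exists_lift {X : ModuleCat.{u} R} (hB : Subsingleton (Ext X B 1))
    (h : ∀ φ : X →ₗ[R] C, ∃ ψ : X →ₗ[R] B, g ∘ₗ ψ = φ) : Subsingleton (Ext X A 1) := by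
  refine subsingleton_of_forall_eq 0 fun x => ?_
  obtain ⟨y, rfl⟩ := Ext.covariant_sequence_exact₁ X (shortExact_mk hf hfg hg) x
    (Subsingleton.elim (h := hB) _ _) (zero_add 1)
  obtain ⟨φ, rfl⟩ := Ext.homEquiv₀.symm.surjective y
  obtain ⟨ψ, hψ⟩ := h φ.hom
  have : φ = ModuleCat.ofHom ψ ≫ ModuleCat.ofHom g := by
    ext x; simp [← hψ]
  subst this
  rw [Ext.homEquiv₀_symm_apply, ← Ext.mk₀_comp_mk₀, Ext.comp_assoc_of_second_deg_zero]
  exact (congrArg (fun t => (Ext.mk₀ (ModuleCat.ofHom ψ)).comp t (zero_add 1))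
    (shortExact_mk hf hfg hg).comp_extClass).trans (Ext.comp_zero ..)

/-- If all maps `A → Y` extend to `B` and `Ext¹(B, Y) = 0`, then `Ext¹(C, Y) = 0`. -/
lemma ext_one_of_exists_extension {Y : ModuleCat.{u} R} (hB : Subsingleton (Ext B Y 1))
    (h : ∀ φ : A →ₗ[R] Y, ∃ ψ : B →ₗ[R] Y, ψ ∘ₗ f = φ) : Subsingleton (Ext C Y 1) := by
  refine subsingleton_of_forall_eq 0 fun x => ?_
  obtain ⟨y, rfl⟩ := Ext.contravariant_sequence_exact₃ (shortExact_mk hf hfg hg) Y x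
    (Subsingleton.elim (h := hB) _ _) (add_zero 1)
  obtain ⟨φ, rfl⟩ := Ext.homEquiv₀.symm.surjective y
  obtain ⟨ψ, hψ⟩ := h φ.hom
  have : φ = ModuleCat.ofHom f ≫ ModuleCat.ofHom ψ := by
    ext x; simp [← hψ]
  subst this
  rw [Ext.homEquiv₀_symm_apply, ← Ext.mk₀_comp_mk₀, ← Ext.comp_assoc_of_second_deg_zero]
  exact (congrArg (fun t => t.comp (Ext.mk₀ (ModuleCat.ofHom ψ)) (add_zero 1))
    (shortExact_mk hf hfg hg).extClass_comp).trans (Ext.zero_comp ..)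

end

lemma ext_of_retract_left {X X' Y : ModuleCat.{u} R} (i : X →ₗ[R] X') (r : X' →ₗ[R] X)
    (h : r ∘ₗ i = LinearMap.id) {n : ℕ} (hX : Subsingleton (Ext X' Y n)) :
    Subsingleton (Ext X Y n) := by
  refine subsingleton_of_forall_eq 0 fun x => ?_
  have h1 : ModuleCat.ofHom i ≫ ModuleCat.ofHom r = 𝟙 X := by
    rw [← ModuleCat.ofHom_comp, h]; rfl
  rw [← x.mk₀_id_comp, ← h1, ← Ext.mk₀_comp_mk₀, Ext.comp_assoc_of_second_deg_zero,
    Subsingleton.elim (h := hX) ((Ext.mk₀ (ModuleCat.ofHom r)).comp x (zero_add n)) 0,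
    Ext.comp_zero]

lemma ext_of_retract_right {X Y Y' : ModuleCat.{u} R} (i : Y →ₗ[R] Y') (r : Y' →ₗ[R] Y)
    (h : r ∘ₗ i = LinearMap.id) {n : ℕ} (hX : Subsingleton (Ext X Y' n)) :
    Subsingleton (Ext X Y n) := by
  refine subsingleton_of_forall_eq 0 fun x => ?_
  have h1 : ModuleCat.ofHom i ≫ ModuleCat.ofHom r = 𝟙 Y := by
    rw [← ModuleCat.ofHom_comp, h]; rfl
  rw [← x.comp_mk₀_id, ← h1, ← Ext.mk₀_comp_mk₀, ← Ext.comp_assoc_of_second_deg_zero,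
    Subsingleton.elim (h := hX) (x.comp (Ext.mk₀ (ModuleCat.ofHom i)) (add_zero n)) 0,
    Ext.zero_comp]

lemma ext_equiv_left {X X' Y : ModuleCat.{u} R} (e : X ≃ₗ[R] X') {n : ℕ}
    (hX : Subsingleton (Ext X' Y n)) : Subsingleton (Ext X Y n) :=
  ext_of_retract_left e.toLinearMap e.symm.toLinearMap (by ext; simp) hX

lemma ext_equiv_right {X Y Y' : ModuleCat.{u} R} (e : Y ≃ₗ[R] Y') {n : ℕ}
    (hX : Subsingleton (Ext X Y' n)) : Subsingleton (Ext X Y n) :=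
  ext_of_retract_right e.toLinearMap e.symm.toLinearMap (by ext; simp) hX

lemma ext_of_projective (X Y : ModuleCat.{u} R) [Module.Projective R X] {n : ℕ} (hn : 1 ≤ n) :
    Subsingleton (Ext X Y n) := by
  obtain ⟨n, rfl⟩ := Nat.exists_eq_add_of_le' hn
  have : Projective X := (IsProjective.iff_projective X).mp inferInstance
  exact Ext.subsingleton_of_projective X Y n

lemma ext_of_injective (X Y : ModuleCat.{u} R) [Module.Injective R Y] {n : ℕ} (hn : 1 ≤ n) :
    Subsingleton (Ext X Y n) := by
  have : Injective Y := Module.injective_object_of_injective_module R Y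
  exact HasInjectiveDimensionLT.subsingleton Y 1 n hn X

lemma ext_of_subsingleton_left (X Y : ModuleCat.{u} R) [Subsingleton X] (n : ℕ) :
    Subsingleton (Ext X Y n) := by
  have := (ModuleCat.isZero_of_subsingleton X).hasProjectiveDimensionLT_zero
  exact HasProjectiveDimensionLT.subsingleton X 0 n (Nat.zero_le n) Y

lemma ext_of_subsingleton_right (X Y : ModuleCat.{u} R) [Subsingleton Y] (n : ℕ) :
    Subsingleton (Ext X Y n) := by
  have := (ModuleCat.isZero_of_subsingleton Y).hasInjectiveDimensionLT_zero
  exact HasInjectiveDimensionLT.subsingleton Y 0 n (Nat.zero_le n) X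

section Pi

variable (R) in
/-- The exact sequence `M → M^{a+1} → M^a` given by the first coordinate. -/
lemma exact_single_funLeft (M : Type u) [AddCommGroup M] [Module R M] (a : ℕ) :
    Function.Exact (LinearMap.single R (fun _ : Fin (a + 1) => M) 0)
      (LinearMap.funLeft R M (Fin.succ : Fin a → Fin (a + 1))) := by
  intro x
  constructor
  · intro h
    refine ⟨x 0, ?_⟩
    ext i
    refine Fin.cases ?_ (fun j => ?_) i
    · simp
    · have : x j.succ = 0 := congrFun h j
      simp [this]
  · rintro ⟨y, rfl⟩
    ext j
    simp [LinearMap.funLeft_apply]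

/-- A property of modules that holds for zero modules and is stable under extensions is stable
under finite powers. -/
lemma pi_induction (P : ModuleCat.{u} R → Prop)
    (h0 : ∀ X : ModuleCat.{u} R, Subsingleton X → P X)
    (hext : ∀ (A B C : ModuleCat.{u} R) (f : A →ₗ[R] B) (g : B →ₗ[R] C), Function.Injective f →
      Function.Exact f g → Function.Surjective g → P A → P C → P B)
    {X : ModuleCat.{u} R} (hX : P X) (a : ℕ) : P (ModuleCat.of R (Fin a → X)) := by
  induction a with
  | zero => exact h0 _ (inferInstanceAs (Subsingleton (Fin 0 → X)))
  | succ a ih =>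
    exact hext X (ModuleCat.of R (Fin (a + 1) → X)) (ModuleCat.of R (Fin a → X))
      (LinearMap.single R (fun _ : Fin (a + 1) => X) 0)
      (LinearMap.funLeft R X (Fin.succ : Fin a → Fin (a + 1)))
      (Pi.single_injective (M := fun _ : Fin (a + 1) => (X : Type u)) 0)
      (exact_single_funLeft R X a)
      (LinearMap.funLeft_surjective_of_injective _ _ _ (Fin.succ_injective a)) hX ih

lemma ext_pi_left {X Y : ModuleCat.{u} R} {n : ℕ} (h : Subsingleton (Ext X Y n)) (a : ℕ) :
    Subsingleton (Ext (ModuleCat.of R (Fin a → X)) Y n) :=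
  pi_induction (fun X => Subsingleton (Ext X Y n)) (fun X _ => ext_of_subsingleton_left X Y n)
    (fun _ _ _ _ _ hf hfg hg => ext_contravariant_mid hf hfg hg) h a

lemma ext_pi_right {X Y : ModuleCat.{u} R} {n : ℕ} (h : Subsingleton (Ext X Y n)) (a : ℕ) :
    Subsingleton (Ext X (ModuleCat.of R (Fin a → Y)) n) :=
  pi_induction (fun Y => Subsingleton (Ext X Y n)) (fun Y _ => ext_of_subsingleton_right X Y n)
    (fun _ _ _ _ _ hf hfg hg => ext_covariant_mid hf hfg hg) h a

lemma hasInjectiveDimensionLT_pi {X : ModuleCat.{u} R} {n : ℕ} (h : HasInjectiveDimensionLT X n)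
    (a : ℕ) : HasInjectiveDimensionLT (ModuleCat.of R (Fin a → X)) n :=
  pi_induction (fun Y => HasInjectiveDimensionLT Y n)
    (fun Y _ => by
      have := (ModuleCat.isZero_of_subsingleton Y).hasInjectiveDimensionLT_zero
      exact hasInjectiveDimensionLT_of_ge Y 0 n (Nat.zero_le n))
    (fun _ _ _ _ _ hf hfg hg => (shortExact_mk hf hfg hg).hasInjectiveDimensionLT_X₂ n) h a

end Pi

/-- The module has finite injective dimension, as the existence of a bound. -/
def FiniteInjDim (X : ModuleCat.{u} R) : Prop := ∃ n : ℕ, HasInjectiveDimensionLT X n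

/-- The module has finite projective dimension, as the existence of a bound. -/
def FiniteProjDim (X : ModuleCat.{u} R) : Prop := ∃ n : ℕ, HasProjectiveDimensionLT X n

lemma injectiveDimension_lt_top_iff {X : ModuleCat.{u} R} :
    injectiveDimension X < ⊤ ↔ FiniteInjDim X := by
  rw [lt_top_iff_ne_top, injectiveDimension_ne_top_iff]
  exact ⟨fun ⟨n, h⟩ => ⟨n + 1, h⟩,
    fun ⟨n, _⟩ => ⟨n, hasInjectiveDimensionLT_of_ge X n (n + 1) n.le_succ⟩⟩

lemma projectiveDimension_lt_top_iff {X : ModuleCat.{u} R} :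
    projectiveDimension X < ⊤ ↔ FiniteProjDim X := by
  rw [lt_top_iff_ne_top, projectiveDimension_ne_top_iff]
  exact ⟨fun ⟨n, h⟩ => ⟨n + 1, h⟩,
    fun ⟨n, _⟩ => ⟨n, hasProjectiveDimensionLT_of_ge X n (n + 1) n.le_succ⟩⟩

lemma FiniteInjDim.of_subsingleton (X : ModuleCat.{u} R) [Subsingleton X] : FiniteInjDim X :=
  ⟨0, (ModuleCat.isZero_of_subsingleton X).hasInjectiveDimensionLT_zero⟩

lemma FiniteInjDim.of_injective (X : ModuleCat.{u} R) [Module.Injective R X] : FiniteInjDim X := by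
  have : Injective X := Module.injective_object_of_injective_module R X
  exact ⟨1, inferInstance⟩

lemma FiniteInjDim.pi {X : ModuleCat.{u} R} (h : FiniteInjDim X) (a : ℕ) :
    FiniteInjDim (ModuleCat.of R (Fin a → X)) :=
  h.imp fun _ hn => hasInjectiveDimensionLT_pi hn a

lemma FiniteInjDim.of_equiv {X Y : ModuleCat.{u} R} (e : X ≃ₗ[R] Y) (h : FiniteInjDim X) :
    FiniteInjDim Y :=
  h.imp fun n (_ : HasInjectiveDimensionLT X n) =>
    hasInjectiveDimensionLT_of_iso (X := X) (X' := Y) e.toModuleIso n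

section
include hf hfg hg

lemma FiniteInjDim.mid (hA : FiniteInjDim A) (hC : FiniteInjDim C) : FiniteInjDim B := by
  obtain ⟨n, hn⟩ := hA
  obtain ⟨m, hm⟩ := hC
  exact ⟨n + m, (shortExact_mk hf hfg hg).hasInjectiveDimensionLT_X₂ (n + m)
    (hasInjectiveDimensionLT_of_ge A n _ (by lia)) (hasInjectiveDimensionLT_of_ge C m _ (by lia))⟩

lemma FiniteInjDim.right (hA : FiniteInjDim A) (hB : FiniteInjDim B) : FiniteInjDim C := by
  obtain ⟨n, hn⟩ := hA
  obtain ⟨m, hm⟩ := hB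
  exact ⟨n + m, (shortExact_mk hf hfg hg).hasInjectiveDimensionLT_X₃ (n + m)
    (hasInjectiveDimensionLT_of_ge B m _ (by lia)) (hasInjectiveDimensionLT_of_ge A n _ (by lia))⟩

lemma FiniteProjDim.right (hA : FiniteProjDim A) (hB : FiniteProjDim B) : FiniteProjDim C := by
  obtain ⟨n, hn⟩ := hA
  obtain ⟨m, hm⟩ := hB
  exact ⟨n + m + 1, (shortExact_mk hf hfg hg).hasProjectiveDimensionLT_X₃ (n + m)
    (hasProjectiveDimensionLT_of_ge A n _ (by lia))
    (hasProjectiveDimensionLT_of_ge B m _ (by lia))⟩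

end

lemma FiniteProjDim.of_projective (X : ModuleCat.{u} R) [Module.Projective R X] :
    FiniteProjDim X := by
  have : Projective X := (IsProjective.iff_projective X).mp inferInstance
  exact ⟨1, inferInstance⟩

lemma FiniteProjDim.of_retract {X Y : ModuleCat.{u} R} (i : X →ₗ[R] Y) (r : Y →ₗ[R] X)
    (h : r ∘ₗ i = LinearMap.id) (hY : FiniteProjDim Y) : FiniteProjDim X := by
  obtain ⟨n, hn⟩ := hY
  exact ⟨n, (Retract.mk (ModuleCat.ofHom i) (ModuleCat.ofHom r)
    (by rw [← ModuleCat.ofHom_comp, h]; rfl)).hasProjectiveDimensionLT n⟩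

end ExtToolkit

/-! ### Finite injective dimension is detected by the residue field -/

section ResidueField

variable {R : Type u} [CommRing R]

/-- If `x ∈ m` is regular on `X`, then `Ext^{n+1}(X/xX, N) = 0` implies `Ext^n(X, N) = 0`:
multiplication by `x` on `Ext^n(X, N)` is surjective, and Nakayama's lemma applies. -/
lemma ext_of_regular_quotient [IsLocalRing R] [IsNoetherianRing R] {X C N : ModuleCat.{u} R}
    [Module.Finite R X] [Module.Finite R N] {x : R} (hx : x ∈ IsLocalRing.maximalIdeal R)
    {g : X →ₗ[R] C} (hreg : IsSMulRegular X x)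
    (hexact : Function.Exact (x • LinearMap.id : X →ₗ[R] X) g)
    (hg : Function.Surjective g) {n : ℕ} (h : Subsingleton (Ext C N (n + 1))) :
    Subsingleton (Ext X N n) := by
  have hinj : Function.Injective (x • LinearMap.id : X →ₗ[R] X) := fun a b hab => hreg hab
  have key : ∀ e : Ext X N n, ∃ e' : Ext X N n, x • e' = e := fun e => by
    obtain ⟨e', he'⟩ := Ext.contravariant_sequence_exact₁ (shortExact_mk hinj hexact hg) N e
      (add_comm 1 n) (Subsingleton.elim (h := h) _ _)
    refine ⟨e', ?_⟩
    have h1 : (ShortComplex.mk (ModuleCat.ofHom (x • LinearMap.id)) (ModuleCat.ofHom g)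
      (by ext y; exact hexact.apply_apply_eq_zero y)).f = x • 𝟙 X := rfl
    rw [← he', h1, Ext.mk₀_smul, Ext.smul_comp, Ext.mk₀_id_comp]
  have hsub : (⊤ : Submodule R (Ext X N n)) ≤ IsLocalRing.maximalIdeal R • ⊤ := fun e _ => by
    obtain ⟨e', rfl⟩ := key e
    exact Submodule.smul_mem_smul hx trivial
  have hbot := Submodule.eq_bot_of_le_smul_of_le_jacobson_bot (IsLocalRing.maximalIdeal R)
    (⊤ : Submodule R (Ext X N n)) Module.Finite.fg_top hsub
    (IsLocalRing.jacobson_eq_maximalIdeal ⊥ bot_ne_top).ge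
  exact subsingleton_of_forall_eq 0 fun e => by
    simpa [hbot] using (Submodule.mem_top : e ∈ (⊤ : Submodule R (Ext X N n)))

lemma factor_sup_span_eq_zero_iff (I : Ideal R) (a : R) (y : R ⧸ I) :
    Submodule.factor (le_sup_left : I ≤ I ⊔ Ideal.span {a}) y = 0 ↔
      ∃ t : R, Submodule.mkQ I (a * t) = y := by
  obtain ⟨r, rfl⟩ := Submodule.mkQ_surjective I y
  constructor
  · intro hy
    have hr : r ∈ I ⊔ Ideal.span {a} := (Submodule.Quotient.mk_eq_zero _).mp hy
    obtain ⟨i, hi, s, hs, rfl⟩ := Submodule.mem_sup.mp hr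
    obtain ⟨t, rfl⟩ := Ideal.mem_span_singleton'.mp hs
    refine ⟨t, ?_⟩
    have h0 : Submodule.mkQ I i = 0 := (Submodule.Quotient.mk_eq_zero _).mpr hi
    rw [map_add, h0, zero_add, mul_comm]
  · rintro ⟨t, ht⟩
    rw [← ht]
    exact (Submodule.Quotient.mk_eq_zero _).mpr
      (Ideal.mul_mem_right _ _ (Ideal.mem_sup_right (Ideal.mem_span_singleton_self a)))

/-- Multiplication by `a` on `R ⧸ I`, viewed as an injection of `R ⧸ (I : a)` with cokernel
`R ⧸ (I + (a))`. -/
lemma exists_exact_colon (I : Ideal R) (a : R) :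
    ∃ (J : Ideal R) (f : (R ⧸ J) →ₗ[R] R ⧸ I), (∀ b, b ∈ J ↔ a * b ∈ I) ∧ Function.Injective f ∧
      Function.Exact f (Submodule.factor (le_sup_left : I ≤ I ⊔ Ideal.span {a})) := by
  let φ : R →ₗ[R] R ⧸ I := (Submodule.mkQ I) ∘ₗ (LinearMap.mulLeft R a)
  refine ⟨LinearMap.ker φ, (LinearMap.ker φ).liftQ φ le_rfl,
    fun b => Submodule.Quotient.mk_eq_zero _, ?_, ?_⟩
  · rw [← LinearMap.ker_eq_bot]
    exact Submodule.ker_liftQ_eq_bot _ _ _ le_rfl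
  · intro y
    rw [factor_sup_span_eq_zero_iff, ← LinearMap.coe_range, Submodule.range_liftQ]
    rfl

/-- Over a Noetherian local ring, vanishing of `Ext^i(k, N)` in all large degrees passes from the
residue field `k` to all cyclic modules, by Noetherian induction on the annihilator. -/
lemma ext_quotient_of_ext_residue [IsLocalRing R] [IsNoetherianRing R] {N : ModuleCat.{u} R}
    [Module.Finite R N] {n : ℕ}
    (h : ∀ i, n ≤ i → Subsingleton (Ext (ModuleCat.of R (R ⧸ IsLocalRing.maximalIdeal R)) N i))
    (I : Ideal R) : ∀ i, n ≤ i → Subsingleton (Ext (ModuleCat.of R (R ⧸ I)) N i) := by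
  induction I using WellFoundedGT.induction with
  | ind I ih =>
  intro i hi
  by_cases hmax : I = IsLocalRing.maximalIdeal R
  · subst hmax
    exact h i hi
  by_cases htop : I = ⊤
  · subst htop
    exact @ext_of_subsingleton_left _ _ _ _ (Ideal.Quotient.subsingleton_iff.mpr rfl) i
  by_cases hp : I.IsPrime
  · obtain ⟨x, hx, hxI⟩ := SetLike.exists_of_lt
      (lt_of_le_of_ne (IsLocalRing.le_maximalIdeal htop) hmax)
    have hlt : I < I ⊔ Ideal.span {x} :=
      lt_of_le_of_ne le_sup_left fun he => hxI (he ▸ Ideal.mem_sup_right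
        (Ideal.mem_span_singleton_self x))
    refine ext_of_regular_quotient (X := ModuleCat.of R (R ⧸ I))
      (C := ModuleCat.of R (R ⧸ (I ⊔ Ideal.span {x})))
      (g := Submodule.factor le_sup_left) hx ?_ ?_ (Submodule.factor_surjective _)
      (ih _ hlt (i + 1) (by lia))
    · rw [isSMulRegular_iff_right_eq_zero_of_smul]
      intro y hy
      obtain ⟨r, rfl⟩ := Submodule.mkQ_surjective I y
      have h2 : x * r ∈ I := (Submodule.Quotient.mk_eq_zero _).mp hy
      exact (Submodule.Quotient.mk_eq_zero _).mpr ((hp.mem_or_mem h2).resolve_left hxI)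
    · intro y
      rw [factor_sup_span_eq_zero_iff]
      constructor
      · rintro ⟨t, rfl⟩
        exact ⟨Submodule.mkQ I t, rfl⟩
      · rintro ⟨z, rfl⟩
        obtain ⟨t, rfl⟩ := Submodule.mkQ_surjective I z
        exact ⟨t, rfl⟩
  · obtain ⟨a, ha, b, hb, hab⟩ := (Ideal.not_isPrime_iff.mp hp).resolve_left htop
    obtain ⟨J, f, hJ, hf, hfg⟩ := exists_exact_colon I a
    have hIJ : I < J := by
      refine lt_of_le_of_ne (fun c hc => (hJ c).mpr (I.mul_mem_left a hc)) fun he => hb ?_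
      rw [he]
      exact (hJ b).mpr hab
    have hlt : I < I ⊔ Ideal.span {a} :=
      lt_of_le_of_ne le_sup_left fun he => ha (he ▸ Ideal.mem_sup_right
        (Ideal.mem_span_singleton_self a))
    exact ext_contravariant_mid (A := ModuleCat.of R (R ⧸ J)) (B := ModuleCat.of R (R ⧸ I))
      (C := ModuleCat.of R (R ⧸ (I ⊔ Ideal.span {a}))) hf hfg (Submodule.factor_surjective _)
      (ih J hIJ i hi) (ih _ hlt i hi)

lemma exists_injective_embedding (N : ModuleCat.{u} R) :
    ∃ (I Z : ModuleCat.{u} R) (f : N →ₗ[R] I) (g : I →ₗ[R] Z), Module.Injective R I ∧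
      Function.Injective f ∧ Function.Exact f g ∧ Function.Surjective g := by
  obtain ⟨I, hI, f, hf⟩ := EnoughInjectives.presentation N
  exact ⟨I, ModuleCat.of R (I ⧸ LinearMap.range f.hom), f.hom,
    Submodule.mkQ _, Module.injective_module_of_injective_object R I,
    (ModuleCat.mono_iff_injective f).mp hf, LinearMap.exact_map_mkQ_range _,
    Submodule.mkQ_surjective _⟩

/-- Baer's criterion in higher degrees, by dimension shifting. -/
lemma hasInjectiveDimensionLT_of_ext_quotient {N : ModuleCat.{u} R} {n : ℕ}
    (h : ∀ I : Ideal R, Subsingleton (Ext (ModuleCat.of R (R ⧸ I)) N (n + 1))) :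
    HasInjectiveDimensionLT N (n + 1) := by
  induction n generalizing N with
  | zero =>
    have : Module.Injective R N := by
      refine Module.Baer.injective fun I φ => ?_
      obtain ⟨ψ, hψ⟩ := exists_extension_of_ext_one (A := ModuleCat.of R I)
        (B := ModuleCat.of R R) (C := ModuleCat.of R (R ⧸ I)) (f := I.subtype) (g := I.mkQ)
        I.injective_subtype (LinearMap.exact_subtype_mkQ I) (Submodule.mkQ_surjective I) (h I) φ
      exact ⟨ψ, fun x hx => LinearMap.congr_fun hψ ⟨x, hx⟩⟩
    have : Injective N := Module.injective_object_of_injective_module R N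
    infer_instance
  | succ n ih =>
    obtain ⟨I, Z, f, g, hI, hf, hfg, hg⟩ := exists_injective_embedding N
    have : Injective I := Module.injective_object_of_injective_module R I
    refine (shortExact_mk hf hfg hg).hasInjectiveDimensionLT_X₁ (n + 1) (ih fun J => ?_)
      (hasInjectiveDimensionLT_of_ge I 1 _ (by lia))
    exact ext_covariant_right hf hfg hg (ext_of_injective _ _ (by lia)) (h J)

/-- Over a Noetherian local ring, the injective dimension of a finitely generated module is
detected by the residue field. -/
lemma hasInjectiveDimensionLT_of_ext_residue [IsLocalRing R] [IsNoetherianRing R]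
    {N : ModuleCat.{u} R} [Module.Finite R N] {n : ℕ}
    (h : ∀ i, n + 1 ≤ i →
      Subsingleton (Ext (ModuleCat.of R (R ⧸ IsLocalRing.maximalIdeal R)) N i)) :
    HasInjectiveDimensionLT N (n + 1) :=
  hasInjectiveDimensionLT_of_ext_quotient fun I =>
    ext_quotient_of_ext_residue h I (n + 1) le_rfl

end ResidueField

/-! ### Totally reflexive modules and G-dimension -/

section TotallyReflexive

variable {R : Type u} [CommRing R]

/-- A linear map that vanishes on the kernel of a surjection factors through it. -/
lemma exists_desc {A B C Y : Type*} [AddCommGroup A] [Module R A] [AddCommGroup B] [Module R B]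
    [AddCommGroup C] [Module R C] [AddCommGroup Y] [Module R Y] {f : A →ₗ[R] B} {g : B →ₗ[R] C}
    (hfg : Function.Exact f g) (hg : Function.Surjective g) (φ : B →ₗ[R] Y)
    (h : ∀ a, φ (f a) = 0) : ∃ ψ : C →ₗ[R] Y, ∀ b, ψ (g b) = φ b := by
  have hle : LinearMap.range f ≤ LinearMap.ker φ := by
    rintro _ ⟨a, rfl⟩
    exact h a
  refine ⟨(LinearMap.range f).liftQ φ hle ∘ₗ (hfg.linearEquivOfSurjective hg).symm.toLinearMap,
    fun b => ?_⟩
  have : (hfg.linearEquivOfSurjective hg).symm (g b) = Submodule.Quotient.mk b := by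
    rw [LinearEquiv.symm_apply_eq]
    rfl
  simp [this]

variable {A B C : ModuleCat.{u} R} {f : A →ₗ[R] B} {g : B →ₗ[R] C}

lemma dualMap_exact (hfg : Function.Exact f g) (hg : Function.Surjective g) :
    Function.Exact g.dualMap f.dualMap := by
  intro φ
  constructor
  · intro h
    obtain ⟨ψ, hψ⟩ := exists_desc hfg hg φ fun a => LinearMap.congr_fun h a
    exact ⟨ψ, by ext b; exact hψ b⟩
  · rintro ⟨ψ, rfl⟩
    ext a
    simp [hfg.apply_apply_eq_zero]

lemma dualMap_surjective_of_ext_one (hf : Function.Injective f) (hfg : Function.Exact f g)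
    (hg : Function.Surjective g) (hC : Subsingleton (Ext C (ModuleCat.of R R) 1)) :
    Function.Surjective f.dualMap := fun φ =>
  exists_extension_of_ext_one hf hfg hg (Y := ModuleCat.of R R) hC φ

lemma IsTotallyReflexive.exists_eval_eq {X : ModuleCat.{u} R} (hX : IsTotallyReflexive X)
    (ξ : Module.Dual R (Module.Dual R X)) : ∃ x : X, ∀ φ : Module.Dual R X, φ x = ξ φ := by
  have := hX.reflexive
  obtain ⟨x, hx⟩ := (Module.bijective_dual_eval R X).2 ξ
  exact ⟨x, fun φ => LinearMap.congr_fun hx φ⟩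

lemma IsTotallyReflexive.eq_zero_of_forall_dual {X : ModuleCat.{u} R} (hX : IsTotallyReflexive X)
    {x : X} (h : ∀ φ : Module.Dual R X, φ x = 0) : x = 0 := by
  have := hX.reflexive
  exact (Module.bijective_dual_eval R X).1 ((LinearMap.ext h).trans (map_zero _).symm)

lemma isReflexive_of_forall {X : ModuleCat.{u} R}
    (hinj : ∀ x : X, (∀ φ : Module.Dual R X, φ x = 0) → x = 0)
    (hsurj : ∀ ξ : Module.Dual R (Module.Dual R X), ∃ x : X, ∀ φ : Module.Dual R X, φ x = ξ φ) :
    Module.IsReflexive R X where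
  bijective_dual_eval' := by
    constructor
    · rw [← LinearMap.ker_eq_bot, LinearMap.ker_eq_bot']
      exact fun x hx => hinj x fun φ => LinearMap.congr_fun hx φ
    · intro ξ
      obtain ⟨x, hx⟩ := hsurj ξ
      exact ⟨x, LinearMap.ext hx⟩

lemma finite_dual [IsNoetherianRing R] (M : Type u) [AddCommGroup M] [Module R M]
    [Module.Finite R M] : Module.Finite R (Module.Dual R M) := inferInstance

lemma IsTotallyReflexive.of_projective (X : ModuleCat.{u} R) [Module.Projective R X]
    [Module.Finite R X] : IsTotallyReflexive X where
  finite := inferInstance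
  reflexive := inferInstance
  ext_self _ hi := ext_of_projective _ _ hi
  ext_dual _ hi := by
    have : Module.Projective R (ModuleCat.of R (Module.Dual R X)) :=
      inferInstanceAs (Module.Projective R (Module.Dual R X))
    exact ext_of_projective _ _ hi

lemma IsTotallyReflexive.dual [IsNoetherianRing R] {X : ModuleCat.{u} R}
    (hX : IsTotallyReflexive X) :
    IsTotallyReflexive (ModuleCat.of R (Module.Dual R X)) where
  finite := by
    have := hX.finite
    exact finite_dual X
  reflexive := by
    have := hX.reflexive
    exact inferInstanceAs (Module.IsReflexive R (Module.Dual R X))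
  ext_self := hX.ext_dual
  ext_dual i hi := by
    have := hX.reflexive
    exact ext_equiv_left (X := ModuleCat.of R (Module.Dual R (Module.Dual R X))) (X' := X)
      (Module.evalEquiv R X).symm (hX.ext_self i hi)

lemma IsTotallyReflexive.kernel [IsNoetherianRing R] (hf : Function.Injective f)
    (hfg : Function.Exact f g) (hg : Function.Surjective g) (hB : IsTotallyReflexive B)
    (hC : IsTotallyReflexive C) : IsTotallyReflexive A := by
  have hfinB := hB.finite
  have hdual := dualMap_surjective_of_ext_one hf hfg hg (hC.ext_self 1 le_rfl)
  have hexact := dualMap_exact hfg hg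
  have hinj := LinearMap.dualMap_injective_of_surjective hg
  refine ⟨Module.Finite.of_injective f hf, isReflexive_of_forall ?_ ?_, ?_, ?_⟩
  · intro a ha
    exact hf ((hB.eq_zero_of_forall_dual fun φ => ha (φ ∘ₗ f)).trans (map_zero f).symm)
  · intro ξ
    obtain ⟨b, hb⟩ := hB.exists_eval_eq (ξ ∘ₗ f.dualMap)
    have hgb : g b = 0 := hC.eq_zero_of_forall_dual fun γ => by
      have h0 : f.dualMap (g.dualMap γ) = 0 := hexact.apply_apply_eq_zero γ
      exact (hb (g.dualMap γ)).trans (by rw [LinearMap.comp_apply, h0, map_zero])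
    obtain ⟨a, rfl⟩ := (hfg b).mp hgb
    refine ⟨a, fun φ => ?_⟩
    obtain ⟨ψ, rfl⟩ := hdual φ
    exact hb ψ
  · intro i hi
    exact ext_contravariant_left hf hfg hg (hB.ext_self i hi) (hC.ext_self (i + 1) (by lia))
  · intro i hi
    obtain ⟨i, rfl⟩ := Nat.exists_eq_add_of_le' hi
    rcases i with _ | i
    · refine ext_one_of_exists_extension (A := ModuleCat.of R (Module.Dual R C))
        (B := ModuleCat.of R (Module.Dual R B)) (C := ModuleCat.of R (Module.Dual R A))
        hinj hexact hdual (hB.ext_dual 1 le_rfl) fun ξ => ?_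
      obtain ⟨c, hc⟩ := hC.exists_eval_eq ξ
      obtain ⟨b, rfl⟩ := hg c
      exact ⟨Module.Dual.eval R B b, LinearMap.ext hc⟩
    · exact ext_contravariant_right (A := ModuleCat.of R (Module.Dual R C))
        (B := ModuleCat.of R (Module.Dual R B)) (C := ModuleCat.of R (Module.Dual R A))
        hinj hexact hdual (hC.ext_dual (i + 1) (by lia)) (hB.ext_dual (i + 2) (by lia))

lemma finite_of_exact (hfg : Function.Exact f g)
    (hg : Function.Surjective g) [Module.Finite R A] [Module.Finite R C] : Module.Finite R B := by
  have : Module.Finite R (LinearMap.range f) := inferInstance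
  have : Module.Finite R (B ⧸ LinearMap.range f) :=
    Module.Finite.equiv (hfg.linearEquivOfSurjective hg).symm
  exact Module.Finite.of_submodule_quotient (LinearMap.range f)

lemma IsTotallyReflexive.extension (hf : Function.Injective f) (hfg : Function.Exact f g)
    (hg : Function.Surjective g) (hA : IsTotallyReflexive A) (hC : IsTotallyReflexive C) :
    IsTotallyReflexive B := by
  have hfinA := hA.finite
  have hfinC := hC.finite
  have hdual := dualMap_surjective_of_ext_one hf hfg hg (hC.ext_self 1 le_rfl)
  have hexact := dualMap_exact hfg hg
  have hinj := LinearMap.dualMap_injective_of_surjective hg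
  refine ⟨finite_of_exact hfg hg, isReflexive_of_forall ?_ ?_, ?_, ?_⟩
  · intro b hb
    have hgb : g b = 0 := hC.eq_zero_of_forall_dual fun γ => hb (γ ∘ₗ g)
    obtain ⟨a, rfl⟩ := (hfg b).mp hgb
    have : a = 0 := hA.eq_zero_of_forall_dual fun φ => by
      obtain ⟨ψ, rfl⟩ := hdual φ
      exact hb ψ
    rw [this, map_zero]
  · intro ξ
    obtain ⟨c, hc⟩ := hC.exists_eval_eq (ξ ∘ₗ g.dualMap)
    obtain ⟨b, rfl⟩ := hg c
    obtain ⟨η, hη⟩ := exists_desc hexact hdual (ξ - Module.Dual.eval R B b) fun γ => by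
      have := hc γ
      simp only [LinearMap.comp_apply] at this
      rw [LinearMap.sub_apply, ← this]
      exact sub_self _
    obtain ⟨a, ha⟩ := hA.exists_eval_eq η
    refine ⟨b + f a, fun φ => ?_⟩
    have h1 := ha (f.dualMap φ)
    rw [hη φ] at h1
    rw [map_add]
    exact (add_comm _ _).trans (eq_sub_iff_add_eq.mp h1)
  · intro i hi
    exact ext_contravariant_mid hf hfg hg (hA.ext_self i hi) (hC.ext_self i hi)
  · intro i hi
    exact ext_contravariant_mid (A := ModuleCat.of R (Module.Dual R C))
        (B := ModuleCat.of R (Module.Dual R B)) (C := ModuleCat.of R (Module.Dual R A))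
        hinj hexact hdual (hC.ext_dual i hi) (hA.ext_dual i hi)

lemma exists_free_cover (X : ModuleCat.{u} R) [Module.Finite R X] :
    ∃ (n : ℕ) (g : (Fin n → R) →ₗ[R] X), Function.Surjective g :=
  Module.Finite.exists_fin' R X

/-- A totally reflexive module embeds into a finite free module with totally reflexive cokernel:
dualize a free cover of its dual. -/
lemma IsTotallyReflexive.exists_cosyzygy [IsNoetherianRing R] {X : ModuleCat.{u} R}
    (hX : IsTotallyReflexive X) :
    ∃ (F X' : ModuleCat.{u} R) (f : X →ₗ[R] F) (g : F →ₗ[R] X'), Module.Free R F ∧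
      Module.Finite R F ∧ IsTotallyReflexive X' ∧
      Function.Injective f ∧ Function.Exact f g ∧ Function.Surjective g := by
  have hdual := hX.dual
  have := hdual.finite
  have hrefl := hX.reflexive
  obtain ⟨n, p, hp⟩ := exists_free_cover (ModuleCat.of R (Module.Dual R X))
  let F₀ := ModuleCat.of R (Fin n → R)
  let L := ModuleCat.of R (LinearMap.ker p)
  let i : L →ₗ[R] F₀ := (LinearMap.ker p).subtype
  have hi : Function.Injective i := Submodule.injective_subtype _
  have hip : Function.Exact i p := LinearMap.exact_subtype_ker_map p
  have hF₀ : IsTotallyReflexive F₀ := IsTotallyReflexive.of_projective _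
  have hL : IsTotallyReflexive L := IsTotallyReflexive.kernel hi hip hp hF₀ hdual
  let e : X ≃ₗ[R] Module.Dual R (Module.Dual R X) := Module.evalEquiv R X
  refine ⟨ModuleCat.of R (Module.Dual R F₀), ModuleCat.of R (Module.Dual R L),
    p.dualMap ∘ₗ e.toLinearMap, i.dualMap, inferInstanceAs (Module.Free R (Module.Dual R F₀)),
    inferInstanceAs (Module.Finite R (Module.Dual R F₀)), hL.dual, ?_, ?_, ?_⟩
  · exact (LinearMap.dualMap_injective_of_surjective hp).comp e.injective
  · exact (LinearEquiv.precomp_exact_iff_exact (e := e)).mpr (dualMap_exact hip hp)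
  · exact dualMap_surjective_of_ext_one hi hip hp (hdual.ext_self 1 le_rfl)

end TotallyReflexive

section Orthogonal

variable {R : Type u} [CommRing R]

/-- The modules `N` that are right orthogonal to totally reflexive modules:
`Ext^i(X, N) = 0` for all totally reflexive `X` and all `i ≥ 1`. -/
def IsTROrthogonal (N : ModuleCat.{u} R) : Prop :=
  ∀ X : ModuleCat.{u} R, IsTotallyReflexive X → ∀ i : ℕ, 1 ≤ i → Subsingleton (Ext X N i)

lemma IsTROrthogonal.mid {A B C : ModuleCat.{u} R} {f : A →ₗ[R] B} {g : B →ₗ[R] C}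
    (hf : Function.Injective f) (hfg : Function.Exact f g) (hg : Function.Surjective g)
    (hA : IsTROrthogonal A) (hC : IsTROrthogonal C) : IsTROrthogonal B := fun X hX i hi =>
  ext_covariant_mid hf hfg hg (hA X hX i hi) (hC X hX i hi)

lemma IsTROrthogonal.pi {N : ModuleCat.{u} R} (h : IsTROrthogonal N) (a : ℕ) :
    IsTROrthogonal (ModuleCat.of R (Fin a → N)) := fun X hX i hi => ext_pi_right (h X hX i hi) a

lemma IsTROrthogonal.free (n : ℕ) : IsTROrthogonal (ModuleCat.of R (Fin n → R)) :=
  IsTROrthogonal.pi (N := ModuleCat.of R R) (fun _ hX => hX.ext_self) n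

variable [IsNoetherianRing R]

lemma IsTROrthogonal.of_finiteInjDim {N : ModuleCat.{u} R} (hN : FiniteInjDim N) :
    IsTROrthogonal N := by
  obtain ⟨n, hn⟩ := hN
  -- Shift `X` to its cosyzygies until the degree exceeds the injective dimension.
  suffices h : ∀ (j : ℕ) (X : ModuleCat.{u} R), IsTotallyReflexive X → ∀ i : ℕ, 1 ≤ i →
      n ≤ i + j → Subsingleton (Ext X N i) from fun X hX i hi => h n X hX i hi (by lia)
  intro j
  induction j with
  | zero => exact fun X _ i _ hij => HasInjectiveDimensionLT.subsingleton N n i hij X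
  | succ j ih =>
    intro X hX i hi hij
    obtain ⟨F, X', f, g, hF, -, hX', hf, hfg, hg⟩ := hX.exists_cosyzygy
    exact ext_contravariant_left hf hfg hg (ext_of_projective F N hi)
      (ih X' hX' (i + 1) (by lia) (by lia))

/-- A right orthogonal class need not be closed under kernels of surjections. This one is, since
every totally reflexive module is the syzygy of a totally reflexive module. -/
lemma IsTROrthogonal.kernel {A B C : ModuleCat.{u} R} {f : A →ₗ[R] B} {g : B →ₗ[R] C}
    (hf : Function.Injective f) (hfg : Function.Exact f g) (hg : Function.Surjective g)
    (hB : IsTROrthogonal B) (hC : IsTROrthogonal C) : IsTROrthogonal A := by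
  intro X hX i hi
  obtain ⟨F, X', f', g', hF, -, hX', hf', hfg', hg'⟩ := hX.exists_cosyzygy
  exact ext_contravariant_left hf' hfg' hg' (ext_of_projective F A hi)
    (ext_covariant_left hf hfg hg (hC X' hX' i hi) (hB X' hX' (i + 1) (by lia)))

end Orthogonal

section Resolution

variable {R : Type u} [CommRing R]

/-- Extensions `0 → X → L → K → 0` with `X` totally reflexive preserve the length of a resolution
of `K`. -/
lemma HasTotallyReflexiveResolution.extension {X L K : ModuleCat.{u} R} {n : ℕ} {f : X →ₗ[R] L}
    {g : L →ₗ[R] K} (hf : Function.Injective f) (hfg : Function.Exact f g)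
    (hg : Function.Surjective g) (hX : IsTotallyReflexive X)
    (hK : HasTotallyReflexiveResolution K n) : HasTotallyReflexiveResolution L n := by
  cases hK with
  | zero _ hK => exact .zero _ (hX.extension hf hfg hg hK)
  | succ K₁ X₀ _ n f₁ g₁ hf₁ hfg₁ hg₁ hX₀ hK₁ =>
    -- The pullback of `L → K ← X₀` is totally reflexive and maps onto `L` with kernel `K₁`.
    let Y := ModuleCat.of R (LinearMap.eqLocus (g ∘ₗ LinearMap.fst R L X₀)
      (g₁ ∘ₗ LinearMap.snd R L X₀))
    have hY : ∀ y : Y, g y.1.1 = g₁ y.1.2 := fun y => y.2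
    let pL : Y →ₗ[R] L := LinearMap.fst R L X₀ ∘ₗ Submodule.subtype _
    let pX : Y →ₗ[R] X₀ := LinearMap.snd R L X₀ ∘ₗ Submodule.subtype _
    let iX : X →ₗ[R] Y := (LinearMap.inl R L X₀ ∘ₗ f).codRestrict _ fun x => by
      simp [LinearMap.mem_eqLocus, hfg.apply_apply_eq_zero]
    let iK : K₁ →ₗ[R] Y := (LinearMap.inr R L X₀ ∘ₗ f₁).codRestrict _ fun x => by
      simp [LinearMap.mem_eqLocus, hfg₁.apply_apply_eq_zero]
    have hYtr : IsTotallyReflexive Y := by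
      refine IsTotallyReflexive.extension (f := iX) (g := pX) ?_ ?_ ?_ hX hX₀
      · intro x y hxy
        exact hf (congrArg (fun z : Y => z.1.1) hxy)
      · intro y
        constructor
        · intro (hy : y.1.2 = 0)
          have h1 := hY y
          rw [hy, map_zero] at h1
          obtain ⟨x, hx⟩ := (hfg _).mp h1
          exact ⟨x, Subtype.ext (Prod.ext hx hy.symm)⟩
        · rintro ⟨x, rfl⟩
          rfl
      · intro x
        obtain ⟨l, hl⟩ := hg (g₁ x)
        exact ⟨⟨(l, x), hl⟩, rfl⟩
    refine .succ K₁ Y L n iK pL ?_ ?_ ?_ hYtr hK₁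
    · intro x y hxy
      exact hf₁ (congrArg (fun z : Y => z.1.2) hxy)
    · intro y
      constructor
      · intro (hy : y.1.1 = 0)
        have h1 := hY y
        rw [hy, map_zero] at h1
        obtain ⟨x, hx⟩ := (hfg₁ _).mp h1.symm
        exact ⟨x, Subtype.ext (Prod.ext hy.symm hx)⟩
      · rintro ⟨x, rfl⟩
        rfl
    · intro l
      obtain ⟨x, hx⟩ := hg₁ (g l)
      exact ⟨⟨(l, x), hx.symm⟩, rfl⟩

/-- A finitely generated module of finite G-dimension that is orthogonal to the totally reflexive
modules has finite projective dimension. In the inductive step the first term of the resolution is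
replaced by a free module. -/
lemma HasTotallyReflexiveResolution.finiteProjDim [IsNoetherianRing R] {N : ModuleCat.{u} R}
    {n : ℕ} (hN : HasTotallyReflexiveResolution N n) (horth : IsTROrthogonal N) :
    FiniteProjDim N := by
  induction n generalizing N with
  | zero =>
    cases hN with
    | zero _ hN =>
      -- `N` is a direct summand of the free module in which it embeds.
      obtain ⟨F, X', f, g, hF, -, hX', hf, hfg, hg⟩ := hN.exists_cosyzygy
      obtain ⟨r, hr⟩ := exists_extension_of_ext_one hf hfg hg (horth X' hX' 1 le_rfl) LinearMap.id
      exact FiniteProjDim.of_retract f r hr (FiniteProjDim.of_projective F)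
  | succ n ih =>
    cases hN with
    | succ K X _ _ f g hf hfg hg hX hK =>
      -- The kernel `L` of a free cover of `N` factoring through `X` is an extension of `K` by the
      -- totally reflexive kernel `Z` of a free cover of `X`.
      have := hX.finite
      obtain ⟨m, p, hp⟩ := exists_free_cover X
      let F := ModuleCat.of R (Fin m → R)
      let L := ModuleCat.of R (LinearMap.ker (g ∘ₗ p))
      let Z := ModuleCat.of R (LinearMap.ker p)
      let i : L →ₗ[R] F := (LinearMap.ker (g ∘ₗ p)).subtype
      have hi : Function.Injective i := Submodule.injective_subtype _
      have hip : Function.Exact i (g ∘ₗ p) := LinearMap.exact_subtype_ker_map _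
      have hgp : Function.Surjective (g ∘ₗ p) := hg.comp hp
      have hZ : IsTotallyReflexive Z := IsTotallyReflexive.kernel (B := F) (C := X)
        (f := (LinearMap.ker p).subtype) (g := p) (Submodule.injective_subtype _)
        (LinearMap.exact_subtype_ker_map _) hp (IsTotallyReflexive.of_projective _) hX
      let j : Z →ₗ[R] L := Submodule.inclusion fun x hx => by
        rw [LinearMap.mem_ker] at hx
        simp [hx]
      let e : K ≃ₗ[R] LinearMap.range f := LinearEquiv.ofInjective f hf
      let q : L →ₗ[R] K := e.symm.toLinearMap ∘ₗ (p ∘ₗ i).codRestrict (LinearMap.range f)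
        fun x => (hfg _).mp x.2
      have hq : ∀ x : L, f (q x) = p x.1 := fun x => by
        have : e (q x) = ⟨p x.1, (hfg _).mp x.2⟩ := e.apply_symm_apply _
        exact congrArg Subtype.val this
      have hL : HasTotallyReflexiveResolution L n := by
        refine HasTotallyReflexiveResolution.extension (f := j) (g := q)
          (Submodule.inclusion_injective _) ?_ ?_ hZ hK
        · intro x
          rw [← map_eq_zero_iff f hf, hq]
          exact ⟨fun hx => ⟨⟨x.1, hx⟩, rfl⟩, fun ⟨z, hz⟩ => hz ▸ z.2⟩
        · intro k
          obtain ⟨x, hx⟩ := hp (f k)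
          have hxL : x ∈ LinearMap.ker (g ∘ₗ p) := by simp [hx, hfg.apply_apply_eq_zero]
          exact ⟨⟨x, hxL⟩, hf ((hq _).trans hx)⟩
      exact FiniteProjDim.right hi hip hgp
        (ih hL (IsTROrthogonal.kernel hi hip hgp (IsTROrthogonal.free m) horth))
        (FiniteProjDim.of_projective F)

lemma exists_totallyReflexiveResolution_of_finiteProjDim [IsNoetherianRing R]
    {N : ModuleCat.{u} R}
    [Module.Finite R N] (hN : FiniteProjDim N) : ∃ n, HasTotallyReflexiveResolution N n := by
  suffices h : ∀ (n : ℕ) (N : ModuleCat.{u} R), Module.Finite R N →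
      HasProjectiveDimensionLT N (n + 1) → HasTotallyReflexiveResolution N n by
    obtain ⟨n, hn⟩ := hN
    exact ⟨n, h n N inferInstance (hasProjectiveDimensionLT_of_ge N n (n + 1) n.le_succ)⟩
  intro n
  induction n with
  | zero =>
    intro N _ hN
    have : Projective N := projective_iff_hasProjectiveDimensionLT_one.mpr hN
    have : Module.Projective R N := (IsProjective.iff_projective N).mpr this
    exact .zero N (IsTotallyReflexive.of_projective N)
  | succ n ih =>
    intro N _ hN
    obtain ⟨m, p, hp⟩ := exists_free_cover N
    let F := ModuleCat.of R (Fin m → R)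
    let L := ModuleCat.of R (LinearMap.ker p)
    let i : L →ₗ[R] F := (LinearMap.ker p).subtype
    have hi : Function.Injective i := Submodule.injective_subtype _
    have hip : Function.Exact i p := LinearMap.exact_subtype_ker_map _
    have hF : Projective F := (IsProjective.iff_projective F).mp inferInstance
    refine .succ L F N n i p hi hip hp (IsTotallyReflexive.of_projective F)
      (ih L (inferInstanceAs (Module.Finite R (LinearMap.ker p))) ?_)
    exact ((shortExact_mk (B := F) hi hip hp).hasProjectiveDimensionLT_X₃_iff n hF).mp hN

lemma gDim_lt_top_iff {N : ModuleCat.{u} R} :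
    gDim N < ⊤ ↔ Subsingleton N ∨ ∃ n, HasTotallyReflexiveResolution N n := by
  unfold gDim
  split_ifs with h
  · simp [h]
  · rw [← WithBot.coe_top, WithBot.coe_lt_coe]
    simp only [iInf_lt_top, h, false_or]
    exact exists_congr fun n => ⟨fun ⟨h, _⟩ => h, fun h => ⟨h, ENat.natCast_lt_top n⟩⟩

/-- For a finitely generated module orthogonal to the totally reflexive modules, the finiteness of
the Gorenstein dimension and of the projective dimension are equivalent. -/
lemma gDim_lt_top_iff_projectiveDimension_lt_top [IsNoetherianRing R]
    {N : ModuleCat.{u} R} [Module.Finite R N]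
    (horth : IsTROrthogonal N) : gDim N < ⊤ ↔ projectiveDimension N < ⊤ := by
  rw [gDim_lt_top_iff, projectiveDimension_lt_top_iff]
  constructor
  · rintro (h | ⟨n, hn⟩)
    · exact ⟨0, (ModuleCat.isZero_of_subsingleton N).hasProjectiveDimensionLT_zero⟩
    · exact hn.finiteProjDim horth
  · exact fun h => Or.inr (exists_totallyReflexiveResolution_of_finiteProjDim h)

end Resolution

/-! ### Syzygies and reducing sequences -/

section Syzygy

variable {R : Type u} [CommRing R] [IsLocalRing R]

/-- Minimality of a generating set of least cardinality: relations among its elements have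
coefficients in the maximal ideal. -/
lemma mem_maximalIdeal_of_linearCombination_eq_zero {M : Type u} [AddCommGroup M] [Module R M]
    {S : Set M} (hspan : Submodule.span R S = ⊤) (hfin : S.Finite)
    (hcard : S.ncard ≤ (⊤ : Submodule R M).spanFinrank) {x : S →₀ R}
    (hx : Finsupp.linearCombination R (Subtype.val : S → M) x = 0) (s : S) :
    x s ∈ IsLocalRing.maximalIdeal R := by
  classical
  by_contra hs
  obtain ⟨c, hc⟩ := (IsLocalRing.notMem_maximalIdeal.mp hs).exists_left_inv
  -- Otherwise `s` lies in the span of the other generators, so that it could be dropped.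
  have hmem : (s : M) ∈ Submodule.span R (S \ {(s : M)}) := by
    have h1 : Finsupp.linearCombination R (Subtype.val : S → M) (x.erase s) =
        - (x s • (s : M)) := by
      rw [Finsupp.erase_eq_sub_single, map_sub, hx, Finsupp.linearCombination_single, zero_sub]
    have h2 : (-c) • Finsupp.linearCombination R (Subtype.val : S → M) (x.erase s) = (s : M) := by
      rw [h1, neg_smul_neg, smul_smul, hc, one_smul]
    have h3 : (-c) • Finsupp.linearCombination R (Subtype.val : S → M) (x.erase s) ∈
        Submodule.span R (S \ {(s : M)}) := by
      refine Submodule.smul_mem _ _ ?_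
      rw [Finsupp.linearCombination_apply]
      refine Submodule.sum_mem _ fun t ht => Submodule.smul_mem _ _ (Submodule.subset_span
        ⟨t.2, fun h => ?_⟩)
      rw [Finsupp.support_erase, Finset.mem_erase] at ht
      exact ht.1 (Subtype.ext h)
    rw [h2] at h3
    exact h3
  have hspan' : Submodule.span R (S \ {(s : M)}) = ⊤ := by
    rw [eq_top_iff, ← hspan, Submodule.span_le]
    intro t ht
    by_cases hts : t = s
    · rw [hts]
      exact hmem
    · exact Submodule.subset_span ⟨ht, hts⟩
  have hle := Submodule.spanFinrank_span_le_ncard_of_finite (R := R)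
    (hfin.subset (Set.sdiff_subset (t := {(s : M)})))
  rw [hspan'] at hle
  exact absurd (hcard.trans hle) (not_le.mpr (Set.ncard_sdiff_singleton_lt_of_mem s.2 hfin))

/-- The exact sequence `0 → Ω M → R^m → M → 0` given by a minimal free cover; the coordinates of
the elements of `Ω M` lie in the maximal ideal. -/
lemma exists_exact_syzygy (M : ModuleCat.{u} R) [Module.Finite R M] :
    ∃ (m : ℕ) (f : syzygy M →ₗ[R] (Fin m → R)) (g : (Fin m → R) →ₗ[R] M),
      Function.Injective f ∧ Function.Exact f g ∧ Function.Surjective g ∧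
        ∀ x i, f x i ∈ IsLocalRing.maximalIdeal R := by
  have hfg : (⊤ : Submodule R M).FG := Module.Finite.fg_top
  have hfin := hfg.finite_generators
  have : Finite (⊤ : Submodule R M).generators := hfin
  obtain ⟨m, ⟨σ⟩⟩ := Finite.exists_equiv_fin (⊤ : Submodule R M).generators
  let p := Finsupp.linearCombination R
    (Subtype.val : ((⊤ : Submodule R M).generators : Set M) → M)
  let e : ((⊤ : Submodule R M).generators →₀ R) ≃ₗ[R] (Fin m → R) :=
    (Finsupp.linearEquivFunOnFinite R R _).trans (LinearEquiv.funCongrLeft R R σ.symm)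
  let i : syzygy M →ₗ[R] ((⊤ : Submodule R M).generators →₀ R) := (LinearMap.ker p).subtype
  have hip : Function.Exact i p := LinearMap.exact_subtype_ker_map p
  refine ⟨m, e.toLinearMap ∘ₗ i, p ∘ₗ e.symm.toLinearMap,
    e.injective.comp (Submodule.injective_subtype _), ?_, ?_, ?_⟩
  · exact (LinearEquiv.conj_exact_iff_exact (e := e) i p).mpr hip
  · have hp : Function.Surjective p := ?_
    · exact hp.comp e.symm.surjective
    rw [← LinearMap.range_eq_top, Finsupp.range_linearCombination, Subtype.range_val]
    exact Submodule.span_generators _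
  · intro x j
    exact mem_maximalIdeal_of_linearCombination_eq_zero (Submodule.span_generators _) hfin
      hfg.generators_ncard.le x.2 (σ.symm j)

lemma syzygyPow_succ {R : Type u} [CommRing R] (n : ℕ) (M : ModuleCat.{u} R) :
    syzygyPow (n + 1) M = syzygy (syzygyPow n M) :=
  Function.iterate_succ_apply' _ _ _

variable [IsNoetherianRing R]

instance finite_syzygy (M : ModuleCat.{u} R) [Module.Finite R M] :
    Module.Finite R (syzygy M) := by
  obtain ⟨m, f, g, hf, -⟩ := exists_exact_syzygy M
  exact Module.Finite.of_injective f hf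

lemma syzygyPow_induction (P : ModuleCat.{u} R → Prop)
    (hsyz : ∀ X : ModuleCat.{u} R, Module.Finite R X → P X → P (syzygy X)) (n : ℕ)
    (X : ModuleCat.{u} R) [hX : Module.Finite R X] (hP : P X) :
    Module.Finite R (syzygyPow n X) ∧ P (syzygyPow n X) := by
  induction n with
  | zero => exact ⟨hX, hP⟩
  | succ n ih =>
    rw [syzygyPow_succ]
    have := ih.1
    exact ⟨inferInstance, hsyz _ ih.1 ih.2⟩

lemma finite_syzygyPow (n : ℕ) (X : ModuleCat.{u} R) [Module.Finite R X] :
    Module.Finite R (syzygyPow n X) :=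
  (syzygyPow_induction (fun _ => True) (fun _ _ _ => trivial) n X trivial).1

/-- A class of modules containing zero and closed under extensions and syzygies contains every
term of a reducing sequence as soon as it contains the first one. -/
lemma IsReducingSequence.forall_mem {H : ModuleCat.{u} R → WithBot ℕ∞} {M : ModuleCat.{u} R}
    {r : ℕ} {K : Fin (r + 1) → ModuleCat.{u} R} (hK : IsReducingSequence H M r K)
    (P : ModuleCat.{u} R → Prop) (h0 : ∀ X : ModuleCat.{u} R, Subsingleton X → P X)
    (hext : ∀ (A B C : ModuleCat.{u} R) (f : A →ₗ[R] B) (g : B →ₗ[R] C), Function.Injective f →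
      Function.Exact f g → Function.Surjective g → P A → P C → P B)
    (hsyz : ∀ X : ModuleCat.{u} R, Module.Finite R X → P X → P (syzygy X))
    (hM : P M) (i : Fin (r + 1)) : P (K i) := by
  induction i using Fin.induction with
  | zero => rwa [hK.zero]
  | succ i ih =>
    obtain ⟨a, b, n, -, -, -, f, g, hf, hfg, hg⟩ := hK.step i
    have := hK.finite i.castSucc
    exact hext (ModuleCat.of R (Fin a → K i.castSucc)) _
      (ModuleCat.of R (Fin b → syzygyPow n (K i.castSucc))) f g hf hfg hg
      (pi_induction P h0 hext ih a)
      (pi_induction P h0 hext (syzygyPow_induction P hsyz n _ ih).2 b)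

lemma IsTROrthogonal.syzygy {X : ModuleCat.{u} R} [Module.Finite R X] (hX : IsTROrthogonal X) :
    IsTROrthogonal (syzygy X) := by
  obtain ⟨m, f, g, hf, hfg, hg, -⟩ := exists_exact_syzygy X
  exact IsTROrthogonal.kernel (B := ModuleCat.of R (Fin m → R)) hf hfg hg (.free m) hX

lemma IsReducingSequence.isTROrthogonal {H : ModuleCat.{u} R → WithBot ℕ∞} {M : ModuleCat.{u} R}
    {r : ℕ} {K : Fin (r + 1) → ModuleCat.{u} R} (hK : IsReducingSequence H M r K)
    (hM : FiniteInjDim M) (i : Fin (r + 1)) : IsTROrthogonal (K i) :=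
  hK.forall_mem IsTROrthogonal
    (fun X _ => .of_finiteInjDim (.of_subsingleton X))
    (fun _ _ _ _ _ hf hfg hg => .mid hf hfg hg) (fun _ _ => .syzygy) (.of_finiteInjDim hM) i

lemma isReducingSequence_gDim_iff {M : ModuleCat.{u} R} (hM : FiniteInjDim M) {r : ℕ}
    {K : Fin (r + 1) → ModuleCat.{u} R} :
    IsReducingSequence (fun N : ModuleCat.{u} R => gDim N) M r K ↔
      IsReducingSequence (fun N : ModuleCat.{u} R => projectiveDimension N) M r K := by
  constructor
  · intro hK
    have := hK.finite (Fin.last r)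
    exact ⟨hK.finite, hK.zero,
      (gDim_lt_top_iff_projectiveDimension_lt_top (hK.isTROrthogonal hM _)).mp hK.last, hK.step⟩
  · intro hK
    have := hK.finite (Fin.last r)
    exact ⟨hK.finite, hK.zero,
      (gDim_lt_top_iff_projectiveDimension_lt_top (hK.isTROrthogonal hM _)).mpr hK.last, hK.step⟩

/-- Every term of a reducing sequence of `M` is orthogonal to the totally reflexive modules, so that
finiteness of the two dimensions at the last term means the same. -/
theorem reducingGDim_eq_reducingProjDim {M : ModuleCat.{u} R} (hM : FiniteInjDim M) :
    reducingGDim M = reducingProjDim M := by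
  simp only [reducingGDim, reducingProjDim, reducingDim, isReducingSequence_gDim_iff hM]

/-- If `Ext^j(K, M) = 0` for all `j ≥ 2`, then `Ext^j(Ω^n K, M) = 0` for all `j, n ≥ 1`. -/
lemma ext_one_syzygyPow {M X : ModuleCat.{u} R} [Module.Finite R X]
    (hX : ∀ j, 2 ≤ j → Subsingleton (Ext X M j)) {n : ℕ} (hn : 0 < n) :
    ∀ j, 1 ≤ j → Subsingleton (Ext (syzygyPow n X) M j) := by
  have key : ∀ Y : ModuleCat.{u} R, Module.Finite R Y → ∀ j, 1 ≤ j →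
      Subsingleton (Ext Y M (j + 1)) → Subsingleton (Ext (syzygy Y) M j) := by
    intro Y _ j hj h
    obtain ⟨m, f, g, hf, hfg, hg, -⟩ := exists_exact_syzygy Y
    exact ext_contravariant_left (B := ModuleCat.of R (Fin m → R)) hf hfg hg
      (ext_of_projective _ _ hj) h
  obtain ⟨n, rfl⟩ := Nat.exists_eq_add_of_le' hn
  have h := syzygyPow_induction (fun Y => ∀ j, 2 ≤ j → Subsingleton (Ext Y M j))
    (fun Y hY h j hj => key Y hY j (by lia) (h (j + 1) (by lia))) n X hX
  intro j hj
  rw [syzygyPow_succ]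
  exact key _ h.1 j hj (h.2 (j + 1) (by lia))

/-- If `Ext^j(M, M) = 0` for `j ≥ 2`, then `M` is a direct summand of every term of a reducing
sequence, since all obstructions to extending `K_{i-1} → M` to `K_i` vanish. -/
lemma IsReducingSequence.exists_retract {H : ModuleCat.{u} R → WithBot ℕ∞} {M : ModuleCat.{u} R}
    {r : ℕ} {K : Fin (r + 1) → ModuleCat.{u} R} (hK : IsReducingSequence H M r K)
    (hM : ∀ j, 2 ≤ j → Subsingleton (Ext M M j)) (i : Fin (r + 1)) :
    ∃ (s : M →ₗ[R] K i) (p : K i →ₗ[R] M), p ∘ₗ s = LinearMap.id := by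
  have hext := hK.forall_mem (fun X => ∀ j, 2 ≤ j → Subsingleton (Ext X M j))
    (fun X _ j _ => ext_of_subsingleton_left X M j)
    (fun _ _ _ _ _ hf hfg hg hA hC j hj => ext_contravariant_mid hf hfg hg (hA j hj) (hC j hj))
    (fun X _ hX j hj => by
      have := ext_one_syzygyPow hX one_pos j (by lia)
      exact this) hM
  induction i using Fin.induction with
  | zero => rw [hK.zero]; exact ⟨LinearMap.id, LinearMap.id, rfl⟩
  | succ i ih =>
    obtain ⟨s, p, hsp⟩ := ih
    obtain ⟨a, b, n, ha, -, hn, f, g, hf, hfg, hg⟩ := hK.step i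
    have := hK.finite i.castSucc
    obtain ⟨ψ, hψ⟩ := exists_extension_of_ext_one (A := ModuleCat.of R (Fin a → K i.castSucc))
      (C := ModuleCat.of R (Fin b → syzygyPow n (K i.castSucc))) (Y := M) hf hfg hg
      (ext_pi_left (ext_one_syzygyPow (hext i.castSucc) hn 1 le_rfl) b)
      (p ∘ₗ LinearMap.proj ⟨0, ha⟩)
    refine ⟨f ∘ₗ LinearMap.single R (fun _ => K i.castSucc) ⟨0, ha⟩ ∘ₗ s, ψ, ?_⟩
    rw [← LinearMap.comp_assoc, hψ]
    ext x
    simpa using LinearMap.congr_fun hsp x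

end Syzygy

/-! ### Modules of large depth have few self-extensions -/

section Depth

variable {R : Type u} [CommRing R] [IsLocalRing R] [IsNoetherianRing R]

/-- There is an `R`-regular sequence `rs` such that the residue field embeds into `R ⧸ (rs)`:
take one of maximal length. -/
lemma exists_isRegular_residue_embedding {d : ℕ} (hd : ringKrullDim R = d) :
    ∃ rs : List R, RingTheory.Sequence.IsRegular R rs ∧ rs.length ≤ d ∧
      (∀ x ∈ rs, x ∈ IsLocalRing.maximalIdeal R) ∧
      ∃ φ : (R ⧸ IsLocalRing.maximalIdeal R) →ₗ[R] (R ⧸ Ideal.ofList rs • (⊤ : Submodule R R)),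
        Function.Injective φ := by
  let P : ℕ → Prop := fun l => ∃ rs : List R, RingTheory.Sequence.IsRegular R rs ∧ rs.length = l
  have hbound : ∀ rs : List R, RingTheory.Sequence.IsRegular R rs → rs.length ≤ d := by
    intro rs hrs
    have h1 := ringKrullDim_add_length_eq_ringKrullDim_of_isRegular rs hrs
    have : Nontrivial (R ⧸ Ideal.ofList rs) := by
      rw [Ideal.Quotient.nontrivial_iff]
      intro h
      exact hrs.top_ne_smul (by simp [h])
    have h2 : 0 ≤ ringKrullDim (R ⧸ Ideal.ofList rs) := ringKrullDim_nonneg_of_nontrivial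
    rw [hd] at h1
    have h3 : (rs.length : WithBot ℕ∞) ≤ (d : WithBot ℕ∞) := by
      rw [← h1]
      exact le_add_of_nonneg_left h2
    exact_mod_cast h3
  obtain ⟨l, ⟨rs, hrs, rfl⟩, hmax⟩ : ∃ l, P l ∧ ∀ l', P l' → l' ≤ l := by
    classical
    have h0 : P 0 := ⟨[], RingTheory.Sequence.IsRegular.nil R R, rfl⟩
    refine ⟨Nat.findGreatest P d, Nat.findGreatest_spec (Nat.zero_le d) h0, fun l' hl' => ?_⟩
    refine Nat.le_findGreatest ?_ hl'
    obtain ⟨rs, hrs, rfl⟩ := hl'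
    exact hbound rs hrs
  have hmem : ∀ x ∈ rs, x ∈ IsLocalRing.maximalIdeal R := by
    have hle : Ideal.ofList rs ≤ IsLocalRing.maximalIdeal R := by
      refine IsLocalRing.le_maximalIdeal fun h => hrs.top_ne_smul (by simp [h])
    exact fun x hx => hle (Ideal.subset_span hx)
  refine ⟨rs, hrs, hbound rs hrs, hmem, ?_⟩
  let N := R ⧸ Ideal.ofList rs • (⊤ : Submodule R R)
  have hnot : ¬ Subsingleton ((R ⧸ IsLocalRing.maximalIdeal R) →ₗ[R] N) := by
    rw [IsSMulRegular.subsingleton_linearMap_iff]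
    rintro ⟨x, hx, hreg⟩
    rw [Ideal.annihilator_quotient] at hx
    have hx' : RingTheory.Sequence.IsRegular R (rs ++ [x]) := by
      rw [IsLocalRing.isRegular_iff_isWeaklyRegular_of_subset_maximalIdeal,
        RingTheory.Sequence.isWeaklyRegular_append_iff,
        RingTheory.Sequence.isWeaklyRegular_singleton_iff]
      · exact ⟨hrs.toIsWeaklyRegular, hreg⟩
      · intro y hy
        rcases List.mem_append.mp hy with hy | hy
        · exact hmem y hy
        · rw [List.mem_singleton.mp hy]
          exact hx
    have := hmax _ ⟨_, hx', rfl⟩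
    simp at this
  have hsimple : IsSimpleModule R (R ⧸ IsLocalRing.maximalIdeal R) :=
    isSimpleModule_iff_isCoatom.mpr (IsLocalRing.maximalIdeal.isMaximal R).out
  rw [not_subsingleton_iff_nontrivial] at hnot
  obtain ⟨φ, hφ⟩ := exists_ne (0 : (R ⧸ IsLocalRing.maximalIdeal R) →ₗ[R] N)
  exact ⟨φ, φ.injective_or_eq_zero.resolve_right hφ⟩

/-- Finite injective dimension of a finitely generated module is bounded by the dimension of the
ring: `Ext^e(k, M) ≠ 0` in the top degree `e`, so that `Ext^e(R ⧸ (rs), M) ≠ 0` for a maximal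
regular sequence `rs`, which forces `e ≤ length rs`. -/
lemma hasInjectiveDimensionLT_of_ringKrullDim {d : ℕ} (hd : ringKrullDim R = d)
    {M : ModuleCat.{u} R} [Module.Finite R M] (hM : FiniteInjDim M) :
    HasInjectiveDimensionLT M (d + 1) := by
  suffices h : ∀ j, HasInjectiveDimensionLT M (d + 1 + j) → HasInjectiveDimensionLT M (d + 1) by
    obtain ⟨n, hn⟩ := hM
    exact h n (hasInjectiveDimensionLT_of_ge M n _ (by lia))
  intro j
  induction j with
  | zero => exact id
  | succ j ih =>
    intro hj
    refine ih ?_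
    rw [show d + 1 + j = (d + j) + 1 by lia]
    refine hasInjectiveDimensionLT_of_ext_residue fun i hi => ?_
    by_cases hij : d + 1 + (j + 1) ≤ i
    · exact HasInjectiveDimensionLT.subsingleton M _ i hij _
    obtain ⟨rs, hrs, hlen, hmem, φ, hφ⟩ := exists_isRegular_residue_embedding hd
    have hpd : HasProjectiveDimensionLT
        (ModuleCat.of R (R ⧸ Ideal.ofList rs • (⊤ : Submodule R R))) (rs.length + 1) := by
      have h1 := ModuleCat.projectiveDimension_quotient_eq_add_length_of_isWeaklyRegular
        (ModuleCat.of R R) rs hrs.toIsWeaklyRegular hmem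
      rw [ModuleCat.projectiveDimension_eq_zero_of_projective (ModuleCat.of R R), zero_add] at h1
      exact (projectiveDimension_le_iff _ _).mp h1.le
    exact ext_contravariant_left
      (A := ModuleCat.of R (R ⧸ IsLocalRing.maximalIdeal R))
      (B := ModuleCat.of R (R ⧸ Ideal.ofList rs • (⊤ : Submodule R R)))
      (C := ModuleCat.of R (_ ⧸ LinearMap.range φ)) (g := Submodule.mkQ _) hφ
      (LinearMap.exact_map_mkQ_range φ) (Submodule.mkQ_surjective _)
      (HasProjectiveDimensionLT.subsingleton _ (rs.length + 1) i (by lia) _)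
      (HasInjectiveDimensionLT.subsingleton M (d + 1 + (j + 1)) (i + 1) (by lia) _)

open scoped Pointwise in
/-- Each element of a regular sequence on `X` lowers by one the degree from which on
`Ext^i(X, M)` vanishes. -/
lemma ext_of_isWeaklyRegular {M : ModuleCat.{u} R} [Module.Finite R M] {n : ℕ}
    (hM : HasInjectiveDimensionLT M n) (rs : List R) :
    ∀ (X : ModuleCat.{u} R), Module.Finite R X → RingTheory.Sequence.IsWeaklyRegular X rs →
      (∀ x ∈ rs, x ∈ IsLocalRing.maximalIdeal R) → ∀ i, n ≤ i + rs.length →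
        Subsingleton (Ext X M i) := by
  induction rs with
  | nil => exact fun X _ _ _ i hi => HasInjectiveDimensionLT.subsingleton M n i hi X
  | cons x rs ih =>
    intro X _ hreg hmem i hi
    rw [RingTheory.Sequence.isWeaklyRegular_cons_iff] at hreg
    refine ext_of_regular_quotient (C := ModuleCat.of R (QuotSMulTop x X))
      (g := Submodule.mkQ (x • ⊤)) (hmem x List.mem_cons_self) hreg.1 ?_
      (Submodule.mkQ_surjective _)
      (ih (ModuleCat.of R (QuotSMulTop x X)) (inferInstanceAs (Module.Finite R (QuotSMulTop x X)))
        hreg.2 (fun y hy => hmem y (List.mem_cons_of_mem x hy)) (i + 1)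
        (by rw [List.length_cons] at hi; lia))
    intro y
    refine (Submodule.Quotient.mk_eq_zero _).trans ?_
    rw [Submodule.mem_smul_pointwise_iff_exists]
    exact ⟨fun ⟨z, _, hz⟩ => ⟨z, hz⟩, fun ⟨z, hz⟩ => ⟨z, trivial, hz⟩⟩

/-- A regular sequence of length at least `d - 1`. If `d ≤ 1` the empty sequence serves, and no
regular sequence in the sense of `IsRegular`, as in the definition of `depth`, is needed. -/
lemma exists_isWeaklyRegular_of_le_depth {R : Type u} [CommRing R] [IsLocalRing R] {M : Type u}
    [AddCommGroup M] [Module R M] {d : ℕ} (hd : (d : ℕ∞) ≤ depth R M + 1) :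
    ∃ rs : List R, RingTheory.Sequence.IsWeaklyRegular M rs ∧
      (∀ x ∈ rs, x ∈ IsLocalRing.maximalIdeal R) ∧ d ≤ rs.length + 1 := by
  by_contra! h
  have h0 : 1 < d := by simpa using h [] (RingTheory.Sequence.IsWeaklyRegular.nil R M) (by simp)
  have hle : depth R M ≤ ((d - 2 : ℕ) : ℕ∞) := by
    refine iSup_le fun rs => iSup_le fun hrs => iSup_le fun hmem => ?_
    have := h rs hrs.toIsWeaklyRegular hmem
    exact_mod_cast (by lia : rs.length ≤ d - 2)
  have h1 : (d : ℕ∞) ≤ ((d - 2 + 1 : ℕ) : ℕ∞) := by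
    rw [Nat.cast_add, Nat.cast_one]
    exact hd.trans (by gcongr)
  have h2 : d ≤ d - 2 + 1 := by exact_mod_cast h1
  lia

/-- A module of finite injective dimension whose depth is at least `dim R - 1` has no
self-extensions in degrees at least two: its injective dimension is at most `dim R`, and a regular
sequence on the first argument of `Ext` lowers this bound by its length. -/
lemma ext_self_of_le_depth {d : ℕ} (hd : ringKrullDim R = d) {M : ModuleCat.{u} R}
    [Module.Finite R M] (hM : FiniteInjDim M) (hdepth : (d : ℕ∞) ≤ depth R M + 1) (j : ℕ)
    (hj : 2 ≤ j) : Subsingleton (Ext M M j) := by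
  obtain ⟨rs, hrs, hmem, hlen⟩ := exists_isWeaklyRegular_of_le_depth hdepth
  exact ext_of_isWeaklyRegular (hasInjectiveDimensionLT_of_ringKrullDim hd hM) rs M inferInstance
    hrs hmem j (by lia)

end Depth

/-! ### Injective resolutions of the ring and the Gorenstein property -/

section GradedInjectiveResolution

/-- An injective resolution `0 → R → I⁰ → I¹ → ⋯`, encoded as one module with an endomorphism `δ`
and submodules `comp q` for `q : ℤ`, the components of the resolution. Indexing by all integers
(with `comp q = 0` for `q < 0`) keeps degree shifts free of casts and case distinctions. -/
structure GradedInjectiveResolution (R : Type u) [CommRing R] where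
  /-- the underlying module -/
  carrier : Type u
  [addCommGroup : AddCommGroup carrier]
  [module : Module R carrier]
  /-- the differential -/
  δ : carrier →ₗ[R] carrier
  /-- the homogeneous components -/
  comp : ℤ → Submodule R carrier
  /-- the augmentation -/
  ε : R →ₗ[R] carrier
  δ_mem : ∀ {q x}, x ∈ comp q → δ x ∈ comp (q + 1)
  δ_δ : ∀ x, δ (δ x) = 0
  ε_mem : ∀ r, ε r ∈ comp 0
  ε_injective : Function.Injective ε
  δ_ε : ∀ r, δ (ε r) = 0
  comp_neg : ∀ {q x}, q < 0 → x ∈ comp q → x = 0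
  exact_zero : ∀ {x}, x ∈ comp 0 → δ x = 0 → ∃ r, ε r = x
  exact_pos : ∀ {q x}, 0 < q → x ∈ comp q → δ x = 0 → ∃ y ∈ comp (q - 1), δ y = x
  injective : ∀ q, Module.Injective R (comp q)

attribute [instance] GradedInjectiveResolution.addCommGroup GradedInjectiveResolution.module

lemma injective_of_equiv {R : Type u} [CommRing R] {I J : Type u} [AddCommGroup I] [Module R I]
    [AddCommGroup J] [Module R J] [Module.Injective R I] (e : I ≃ₗ[R] J) :
    Module.Injective R J where
  out X Y _ _ _ _ f hf g := by
    obtain ⟨h, hh⟩ := Module.Injective.out f hf (e.symm.toLinearMap ∘ₗ g)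
    exact ⟨e.toLinearMap ∘ₗ h, fun x => by simp [hh x]⟩

theorem exists_gradedInjectiveResolution (R : Type u) [CommRing R] :
    Nonempty (GradedInjectiveResolution R) := by
  classical
  choose I Z f g hI hf hfg hg using exists_injective_embedding (R := R)
  -- `Zs n` is the `n`-th cosyzygy and `Is n` the injective module into which it embeds.
  let Zs : ℕ → ModuleCat.{u} R := fun n => Nat.rec (ModuleCat.of R R) (fun _ X => Z X) n
  let Is : ℕ → Type u := fun n => I (Zs n)
  let d : ∀ n, Is n →ₗ[R] Is (n + 1) := fun n => f (Zs (n + 1)) ∘ₗ g (Zs n)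
  let C : ℤ → Submodule R (∀ n, Is n) := fun q =>
    { carrier := {x | ∀ n : ℕ, (n : ℤ) ≠ q → x n = 0}
      add_mem' := fun hx hy n hn => by rw [Pi.add_apply, hx n hn, hy n hn, add_zero]
      zero_mem' := fun _ _ => rfl
      smul_mem' := fun c x hx n hn => by rw [Pi.smul_apply, hx n hn, smul_zero] }
  let δ : (∀ n, Is n) →ₗ[R] (∀ n, Is n) := LinearMap.pi fun n =>
    match n with
    | 0 => 0
    | n + 1 => d n ∘ₗ LinearMap.proj n
  have hδ0 : ∀ x, δ x 0 = 0 := fun _ => rfl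
  have hδ : ∀ x n, δ x (n + 1) = d n (x n) := fun _ _ => rfl
  have hdd : ∀ n x, d (n + 1) (d n x) = 0 := fun n x => by
    simp [d, (hfg (Zs (n + 1))).apply_apply_eq_zero]
  refine ⟨{
    carrier := ∀ n, Is n
    δ := δ
    comp := C
    ε := LinearMap.single R Is 0 ∘ₗ f (ModuleCat.of R R)
    δ_mem := ?_
    δ_δ := ?_
    ε_mem := ?_
    ε_injective := ?_
    δ_ε := ?_
    comp_neg := ?_
    exact_zero := ?_
    exact_pos := ?_
    injective := ?_ }⟩
  · intro q x hx n hn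
    rcases n with _ | n
    · rfl
    · rw [hδ, hx n (fun h => hn (by push_cast; rw [h])), map_zero]
  · intro x
    funext n
    rcases n with _ | _ | n
    · rfl
    · rw [hδ, hδ0, map_zero]
      rfl
    · rw [hδ, hδ, hdd]
      rfl
  · intro r n hn
    have : n ≠ 0 := fun h => hn (by simp [h])
    simp [this]
  · exact (Pi.single_injective (M := Is) 0).comp (hf _)
  · intro r
    funext n
    rcases n with _ | _ | n
    · rfl
    · rw [hδ]
      simp [d, (hfg (ModuleCat.of R R)).apply_apply_eq_zero, Zs]
    · rw [hδ]
      simp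
  · intro q x hq hx
    funext n
    exact hx n (by lia)
  · intro x hx hδx
    have h1 : d 0 (x 0) = 0 := (hδ x 0).symm.trans (congrFun hδx _)
    have h2 : g (Zs 0) (x 0) = 0 := hf _ (h1.trans (map_zero _).symm)
    obtain ⟨r, hr⟩ := (hfg _ _).mp h2
    refine ⟨r, ?_⟩
    funext n
    rcases n with _ | n
    · exact hr
    · rw [hx (n + 1) (by lia)]
      simp
  · intro q x hq hx hδx
    obtain ⟨n, rfl⟩ : ∃ n : ℕ, q = n + 1 := ⟨(q - 1).toNat, by lia⟩
    have h1 : d (n + 1) (x (n + 1)) = 0 := (hδ x (n + 1)).symm.trans (congrFun hδx _)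
    have h2 : g (Zs (n + 1)) (x (n + 1)) = 0 := hf _ (h1.trans (map_zero _).symm)
    obtain ⟨z, hz⟩ := (hfg _ _).mp h2
    obtain ⟨y, rfl⟩ := hg (Zs n) z
    refine ⟨Pi.single n y, fun k hk => ?_, ?_⟩
    · exact Pi.single_eq_of_ne (fun h => hk (by simp [h])) _
    · funext k
      rcases k with _ | k
      · rw [hδ0, hx 0 (by lia)]
      · rw [hδ]
        by_cases hk : k = n
        · subst hk
          rw [Pi.single_eq_same]
          exact hz
        · rw [Pi.single_eq_of_ne hk, map_zero, hx (k + 1) (by lia)]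
  · intro q
    by_cases hq : 0 ≤ q
    · obtain ⟨n, rfl⟩ := Int.eq_ofNat_of_zero_le hq
      have : Module.Injective R (Is n) := hI _
      refine injective_of_equiv (I := Is n) (LinearEquiv.ofBijective
        ((LinearMap.single R Is n).codRestrict (C n) fun x k hk => ?_) ⟨?_, ?_⟩)
      · exact Pi.single_eq_of_ne (fun h => hk (by simp [h])) _
      · intro x y hxy
        exact Pi.single_injective (M := Is) n (congrArg Subtype.val hxy)
      · intro x
        refine ⟨x.1 n, Subtype.ext (funext fun k => ?_)⟩
        by_cases hk : k = n
        · subst hk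
          exact Pi.single_eq_same k (x.1 k)
        · rw [x.2 k (by lia)]
          exact Pi.single_eq_of_ne hk _
    · exact ⟨fun X Y _ _ _ _ f hf g => ⟨0, fun x => Subtype.ext (funext fun n =>
        ((g x).2 n (by lia)).symm)⟩⟩

namespace GradedInjectiveResolution

variable {R : Type u} [CommRing R] (I : GradedInjectiveResolution R)

/-- The cocycles of degree `q`. -/
def cocycles (q : ℤ) : Submodule R I.carrier := I.comp q ⊓ LinearMap.ker I.δ

/-- The sequence `0 → Z^q → I^q → Z^{q+1} → 0` for `q ≥ 0`. -/
lemma exact_cocycles {q : ℤ} (hq : 0 ≤ q) :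
    ∃ (f : I.cocycles q →ₗ[R] I.comp q) (g : I.comp q →ₗ[R] I.cocycles (q + 1)),
      Function.Injective f ∧ Function.Exact f g ∧ Function.Surjective g ∧
        ∀ x, (g x : I.carrier) = I.δ x := by
  refine ⟨Submodule.inclusion inf_le_left,
    (I.δ ∘ₗ (I.comp q).subtype).codRestrict _ fun x => ⟨I.δ_mem x.2, I.δ_δ x.1⟩,
    Submodule.inclusion_injective _, fun x => ?_, fun x => ?_, fun x => rfl⟩
  · constructor
    · intro h
      exact ⟨⟨x.1, x.2, congrArg Subtype.val h⟩, rfl⟩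
    · rintro ⟨y, rfl⟩
      exact Subtype.ext y.2.2
  · obtain ⟨y, hy, hyx⟩ := I.exact_pos (by lia) x.2.1 x.2.2
    exact ⟨⟨y, by rwa [add_sub_cancel_right] at hy⟩, Subtype.ext hyx⟩

/-- Dimension shifting along the resolution. -/
lemma ext_of_ext_cocycles {X : ModuleCat.{u} R} (q : ℕ) :
    ∀ i, 1 ≤ i → Subsingleton (Ext X (ModuleCat.of R (I.cocycles q)) i) →
      Subsingleton (Ext X (ModuleCat.of R R) (i + q)) := by
  induction q with
  | zero =>
    intro i _ h
    refine ext_equiv_right (Y' := ModuleCat.of R (I.cocycles 0)) (LinearEquiv.ofBijective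
      (I.ε.codRestrict (I.cocycles 0) fun r => ⟨I.ε_mem r, I.δ_ε r⟩)
      ⟨fun r s hrs => ?_, fun x => ?_⟩) h
    · exact I.ε_injective (congrArg Subtype.val hrs)
    · obtain ⟨r, hr⟩ := I.exact_zero x.2.1 x.2.2
      exact ⟨r, Subtype.ext hr⟩
  | succ q ih =>
    intro i hi h
    rw [show i + (q + 1) = (i + 1) + q by lia]
    refine ih (i + 1) (by lia) ?_
    obtain ⟨f, g, hf, hfg, hg, -⟩ := I.exact_cocycles (q := q) (by lia)
    have := I.injective q
    exact ext_covariant_left (A := ModuleCat.of R (I.cocycles q)) (B := ModuleCat.of R (I.comp q))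
      (C := ModuleCat.of R (I.cocycles (q + 1))) hf hfg hg h
      (ext_of_injective _ (ModuleCat.of R (I.comp q)) (by lia))

end GradedInjectiveResolution

end GradedInjectiveResolution

/-- The linear map `R ⧸ I → Y` determined by an element killed by `I`. -/
lemma exists_linearMap_quotient {R : Type u} [CommRing R] {Y : Type*} [AddCommGroup Y]
    [Module R Y] (I : Ideal R) (y : Y) (hy : ∀ r ∈ I, r • y = 0) :
    ∃ φ : (R ⧸ I) →ₗ[R] Y, φ (Submodule.mkQ I 1) = y :=
  ⟨Submodule.liftQ I (LinearMap.toSpanSingleton R Y y) hy, one_smul R y⟩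

lemma smul_apply_quotient_one {R : Type u} [CommRing R] {Y : Type*} [AddCommGroup Y]
    [Module R Y] (I : Ideal R) (φ : (R ⧸ I) →ₗ[R] Y) {r : R} (hr : r ∈ I) :
    r • φ (Submodule.mkQ I 1) = 0 := by
  rw [← map_smul, ← map_smul, smul_eq_mul, mul_one, Submodule.mkQ_apply,
    (Submodule.Quotient.mk_eq_zero I).mpr hr, map_zero]

lemma linearMap_quotient_ext {R : Type u} [CommRing R] {Y : Type*} [AddCommGroup Y]
    [Module R Y] (I : Ideal R) {φ ψ : (R ⧸ I) →ₗ[R] Y}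
    (h : φ (Submodule.mkQ I 1) = ψ (Submodule.mkQ I 1)) : φ = ψ :=
  Submodule.linearMap_qext I (LinearMap.ext_ring h)

/-- If socle elements of `Z^{q+1}` lift to socle elements of `I^q` for all large `q`, then
`Ext^i(k, R) = 0` for all large `i`, so that `R` has finite injective dimension. -/
lemma isGorenstein_of_socle_lift {R : Type u} [CommRing R] [IsLocalRing R] [IsNoetherianRing R]
    (I : GradedInjectiveResolution R) (n : ℕ)
    (h : ∀ q : ℕ, n ≤ q → ∀ s ∈ I.comp (q + 1), I.δ s = 0 →
      (∀ r ∈ IsLocalRing.maximalIdeal R, r • s = 0) →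
      ∃ t ∈ I.comp q, (∀ r ∈ IsLocalRing.maximalIdeal R, r • t = 0) ∧ I.δ t = s) :
    IsGorenstein R := by
  refine injectiveDimension_lt_top_iff.mpr ⟨n + 1 + 1, hasInjectiveDimensionLT_of_ext_residue
    fun i hi => ?_⟩
  obtain ⟨q, hq, rfl⟩ : ∃ q, n ≤ q ∧ i = 1 + q := ⟨i - 1, by lia, by lia⟩
  refine I.ext_of_ext_cocycles q 1 le_rfl ?_
  obtain ⟨f, g, hf, hfg, hg, hgδ⟩ := I.exact_cocycles (q := q) (by lia)
  have := I.injective q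
  refine ext_one_of_exists_lift (A := ModuleCat.of R (I.cocycles q))
    (B := ModuleCat.of R (I.comp q)) (C := ModuleCat.of R (I.cocycles (q + 1))) hf hfg hg
    (ext_of_injective _ (ModuleCat.of R (I.comp q)) le_rfl) fun φ => ?_
  obtain ⟨t, ht, htm, hts⟩ := h q hq (φ (Submodule.mkQ _ 1)).1 (φ (Submodule.mkQ _ 1)).2.1
    (φ (Submodule.mkQ _ 1)).2.2
    fun r hr => congrArg Subtype.val (smul_apply_quotient_one _ φ hr)
  obtain ⟨ψ, hψ⟩ := exists_linearMap_quotient (IsLocalRing.maximalIdeal R)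
    (⟨t, ht⟩ : I.comp q) fun r hr => Subtype.ext (htm r hr)
  refine ⟨ψ, linearMap_quotient_ext _ (Subtype.ext ?_)⟩
  rw [LinearMap.comp_apply, hψ, hgδ]
  exact hts

/-! ### Minimal complexes with homology of finite injective dimension -/

section MinimalComplex

/-- A bounded complex of finitely generated free modules over a local ring whose differential has
entries in the maximal ideal: a finite graded basis `B` together with the matrix of the
differential, which lowers degrees by one. -/
structure MinimalComplex (R : Type u) [CommRing R] [IsLocalRing R] where
  /-- the basis -/
  B : Type
  [fintype : Fintype B]
  /-- the degrees of the basis elements -/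
  deg : B → ℕ
  /-- the matrix of the differential -/
  d : B → B → R
  deg_eq : ∀ {b c}, d b c ≠ 0 → deg c = deg b + 1
  d_mem : ∀ b c, d b c ∈ IsLocalRing.maximalIdeal R
  d_d : ∀ b e, ∑ c, d b c * d c e = 0

attribute [instance] MinimalComplex.fintype

namespace MinimalComplex

variable {R : Type u} [CommRing R] [IsLocalRing R] (P : MinimalComplex R)

/-- The differential of the complex with coefficients in a module `T`. -/
def diff (T : Type*) [AddCommGroup T] [Module R T] : (P.B → T) →ₗ[R] (P.B → T) :=
  LinearMap.pi fun b => ∑ c, P.d b c • LinearMap.proj c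

lemma diff_apply {T : Type*} [AddCommGroup T] [Module R T] (x : P.B → T) (b : P.B) :
    P.diff T x b = ∑ c, P.d b c • x c := by
  simp [diff, LinearMap.sum_apply]

lemma diff_diff {T : Type*} [AddCommGroup T] [Module R T] (x : P.B → T) :
    P.diff T (P.diff T x) = 0 := by
  funext b
  simp only [diff_apply, Finset.smul_sum, smul_smul]
  rw [Finset.sum_comm]
  simp [← Finset.sum_smul, P.d_d]

lemma diff_apply_eq_zero {T : Type*} [AddCommGroup T] [Module R T] {x : P.B → T} {b : P.B}
    (h : ∀ c, P.deg c = P.deg b + 1 → x c = 0) : P.diff T x b = 0 := by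
  rw [diff_apply]
  refine Finset.sum_eq_zero fun c _ => ?_
  by_cases hd : P.d b c = 0
  · rw [hd, zero_smul]
  · rw [h c (P.deg_eq hd), smul_zero]

lemma diff_apply_eq_zero_of_socle {T : Type*} [AddCommGroup T] [Module R T] {x : P.B → T}
    (h : ∀ c, ∀ r ∈ IsLocalRing.maximalIdeal R, r • x c = 0) : P.diff T x = 0 := by
  funext b
  rw [diff_apply]
  exact Finset.sum_eq_zero fun c _ => h c _ (P.d_mem b c)

/-- The homogeneous component of degree `j` of the complex. -/
def comp (j : ℕ) : Submodule R (P.B → R) where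
  carrier := {x | ∀ b, P.deg b ≠ j → x b = 0}
  add_mem' hx hy b hb := by rw [Pi.add_apply, hx b hb, hy b hb, add_zero]
  zero_mem' _ _ := rfl
  smul_mem' c x hx b hb := by rw [Pi.smul_apply, hx b hb, smul_zero]

/-- The cycles of degree `j`. -/
def cycles (j : ℕ) : Submodule R (P.B → R) := P.comp j ⊓ LinearMap.ker (P.diff R)

/-- The homology in degree `j` has finite injective dimension. The homology is represented by any
module `N` with a surjection from the cycles whose kernel consists of the boundaries. -/
def HomologyFiniteInjDim (j : ℕ) : Prop :=
  ∃ (N : ModuleCat.{u} R) (h : P.cycles j →ₗ[R] N), Function.Surjective h ∧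
    (∀ z : P.cycles j, h z = 0 ↔ ∃ y ∈ P.comp (j + 1), P.diff R y = z) ∧ FiniteInjDim N

section Total

variable (I : GradedInjectiveResolution R)

/-- The component of degree `m` of the total complex of the tensor product of `P` with the
injective resolution `I`. -/
def total (m : ℤ) : Submodule R (P.B → I.carrier) :=
  Submodule.pi Set.univ fun b => I.comp (m + P.deg b)

lemma mem_total {m : ℤ} {x : P.B → I.carrier} :
    x ∈ P.total I m ↔ ∀ b, x b ∈ I.comp (m + P.deg b) := by
  simp [total, Submodule.mem_pi]

/-- The differential of the total complex. The sign on the differential of `I` makes it square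
to zero. -/
def totalDiff : (P.B → I.carrier) →ₗ[R] (P.B → I.carrier) :=
  (LinearMap.pi fun b => (-1 : R) ^ P.deg b • (I.δ ∘ₗ LinearMap.proj b)) + P.diff I.carrier

lemma totalDiff_apply (x : P.B → I.carrier) (b : P.B) :
    P.totalDiff I x b = (-1 : R) ^ P.deg b • I.δ (x b) + P.diff I.carrier x b := rfl

lemma totalDiff_mem {m : ℤ} {x : P.B → I.carrier} (hx : x ∈ P.total I m) :
    P.totalDiff I x ∈ P.total I (m + 1) := by
  rw [mem_total] at hx ⊢
  intro b
  rw [totalDiff_apply, diff_apply]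
  refine add_mem (Submodule.smul_mem _ _ ?_) (sum_mem fun c _ => ?_)
  · have := I.δ_mem (hx b)
    rwa [add_right_comm] at this
  · by_cases hd : P.d b c = 0
    · rw [hd, zero_smul]
      exact zero_mem _
    · refine Submodule.smul_mem _ _ ?_
      have := hx c
      rw [P.deg_eq hd] at this
      rwa [Nat.cast_add, Nat.cast_one, add_comm (P.deg b : ℤ), ← add_assoc] at this

lemma totalDiff_totalDiff (x : P.B → I.carrier) : P.totalDiff I (P.totalDiff I x) = 0 := by
  funext b
  have h1 : P.diff I.carrier (P.totalDiff I x) b =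
      - ((-1 : R) ^ P.deg b • I.δ (P.diff I.carrier x b)) := by
    have h2 : P.totalDiff I x = (fun c => (-1 : R) ^ P.deg c • I.δ (x c)) + P.diff I.carrier x :=
      rfl
    rw [h2, map_add, diff_diff, add_zero, diff_apply, diff_apply, map_sum, Finset.smul_sum,
      ← Finset.sum_neg_distrib]
    refine Finset.sum_congr rfl fun c _ => ?_
    by_cases hd : P.d b c = 0
    · simp [hd]
    · rw [P.deg_eq hd, map_smul, smul_smul, smul_smul, ← neg_smul, pow_succ]
      ring_nf
  rw [totalDiff_apply, h1, totalDiff_apply, map_add, map_smul, I.δ_δ, smul_zero, zero_add,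
    add_neg_cancel]
  rfl

lemma totalDiff_ε (p : P.B → R) :
    P.totalDiff I (fun b => I.ε (p b)) = fun b => I.ε (P.diff R p b) := by
  funext b
  rw [totalDiff_apply, I.δ_ε, smul_zero, zero_add, diff_apply, diff_apply, map_sum]
  exact Finset.sum_congr rfl fun c _ => (map_smul I.ε _ _).symm

/-- The columns `R^B → I⁰ ⊗ R^B → I¹ ⊗ R^B → ⋯` are exact. Hence an element `x` of the total
complex can be pushed, modulo boundaries, into the column of `R^B`, as long as `D x` vanishes in
the positive rows. -/
lemma exists_eq_totalDiff_add {m : ℤ} {x : P.B → I.carrier} (hx : x ∈ P.total I m)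
    (hDx : ∀ b, -m ≤ P.deg b → P.totalDiff I x b = 0) :
    ∃ w ∈ P.total I (m - 1), ∃ p : P.B → R, (∀ b, (P.deg b : ℤ) ≠ -m → p b = 0) ∧
      x = P.totalDiff I w + fun b => I.ε (p b) := by
  classical
  suffices h : ∀ (N : ℕ) (x : P.B → I.carrier), x ∈ P.total I m →
      (∀ b, -m ≤ P.deg b → P.totalDiff I x b = 0) → (∀ b, N ≤ P.deg b → x b = 0) →
      ∃ w ∈ P.total I (m - 1), ∃ p : P.B → R, (∀ b, (P.deg b : ℤ) ≠ -m → p b = 0) ∧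
        x = P.totalDiff I w + fun b => I.ε (p b) from
    h (Finset.univ.sup P.deg + 1) x hx hDx fun b hb => by
      have := Finset.le_sup (f := P.deg) (Finset.mem_univ b)
      lia
  intro N
  induction N with
  | zero =>
    intro x _ _ hN
    refine ⟨0, zero_mem _, 0, fun _ _ => rfl, ?_⟩
    funext b
    simp [hN b (Nat.zero_le _)]
  | succ N ih =>
    intro x hx hDx hN
    have hδ : ∀ b, P.deg b = N → -m ≤ P.deg b → I.δ (x b) = 0 := by
      intro b hb hm
      have h1 := hDx b hm
      rw [totalDiff_apply, P.diff_apply_eq_zero fun c hc => hN c (by lia), add_zero] at h1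
      have h2 := congrArg (fun t => (-1 : R) ^ P.deg b • t) h1
      simpa [smul_smul, ← mul_pow] using h2
    have hx' := (P.mem_total I).mp hx
    by_cases hNm : (N : ℤ) ≤ -m
    · -- All components of degree other than `-m` vanish, and those of degree `-m` come from `R`.
      have key : ∀ b, ∃ r : R, I.ε r = x b ∧ ((P.deg b : ℤ) ≠ -m → r = 0) := by
        intro b
        by_cases hb : (P.deg b : ℤ) = -m
        · have h0 : x b ∈ I.comp 0 := by
            have := hx' b
            rwa [hb, add_neg_cancel] at this
          by_cases hbN : P.deg b = N
          · obtain ⟨r, hr⟩ := I.exact_zero h0 (hδ b hbN hb.ge)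
            exact ⟨r, hr, fun h => absurd hb h⟩
          · exact ⟨0, by rw [map_zero, hN b (by lia)], fun _ => rfl⟩
        · refine ⟨0, ?_, fun _ => rfl⟩
          rw [map_zero]
          by_cases hbN : N + 1 ≤ P.deg b
          · exact (hN b hbN).symm
          · exact (I.comp_neg (by lia) (hx' b)).symm
      choose p hp hp0 using key
      exact ⟨0, zero_mem _, p, hp0, by rw [map_zero, zero_add]; exact funext fun b => (hp b).symm⟩
    · -- Subtract a boundary that kills the components of top degree `N`.
      have key : ∀ b, ∃ y ∈ I.comp (m + P.deg b - 1), (P.deg b = N → I.δ y = x b) ∧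
          (P.deg b ≠ N → y = 0) := by
        intro b
        by_cases hb : P.deg b = N
        · obtain ⟨y, hy, hyx⟩ := I.exact_pos (by lia) (hx' b) (hδ b hb (by lia))
          exact ⟨y, hy, fun _ => hyx, fun h => absurd hb h⟩
        · exact ⟨0, zero_mem _, fun h => absurd h hb, fun _ => rfl⟩
      choose y hy hyx hy0 using key
      let w : P.B → I.carrier := fun b => (-1 : R) ^ P.deg b • y b
      have hw : w ∈ P.total I (m - 1) := by
        rw [mem_total]
        intro b
        have := hy b
        rw [show m + (P.deg b : ℤ) - 1 = m - 1 + P.deg b by ring] at this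
        exact Submodule.smul_mem _ _ this
      have hw0 : ∀ b, P.deg b ≠ N → w b = 0 := fun b hb => by simp [w, hy0 b hb]
      have hDw : ∀ b, N ≤ P.deg b → P.totalDiff I w b = x b := by
        intro b hb
        rw [totalDiff_apply, P.diff_apply_eq_zero fun c hc => hw0 c (by lia), add_zero]
        by_cases hbN : P.deg b = N
        · simp [w, smul_smul, ← mul_pow, hyx b hbN]
        · rw [hw0 b hbN, hN b (by lia), map_zero, smul_zero]
      have hmem := P.totalDiff_mem I hw
      rw [sub_add_cancel] at hmem
      obtain ⟨w', hw', p, hp, hxp⟩ := ih (x - P.totalDiff I w) (sub_mem hx hmem)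
        (fun b hb => by rw [map_sub, totalDiff_totalDiff, sub_zero, hDx b hb])
        (fun b hb => by rw [Pi.sub_apply, hDw b hb, sub_self])
      refine ⟨w + w', add_mem hw hw', p, hp, ?_⟩
      rw [map_add, add_assoc, ← hxp, add_sub_cancel]

/-- The cocycles of degree `m` of the total complex. -/
def totalCocycles (m : ℤ) : Submodule R (P.B → I.carrier) :=
  P.total I m ⊓ LinearMap.ker (P.totalDiff I)

lemma injective_total (m : ℤ) : Module.Injective R (P.total I m) where
  out X Y _ _ _ _ f hf g := by
    have h1 : ∀ b, ∃ h : Y →ₗ[R] I.comp (m + P.deg b), ∀ x, (h (f x) : I.carrier) = (g x).1 b := by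
      intro b
      have := I.injective (m + P.deg b)
      obtain ⟨h, hh⟩ := Module.Injective.out f hf
        ((LinearMap.proj b ∘ₗ Submodule.subtype _ ∘ₗ g).codRestrict (I.comp (m + P.deg b))
          fun x => (P.mem_total I).mp (g x).2 b)
      exact ⟨h, fun x => congrArg Subtype.val (hh x)⟩
    choose h hh using h1
    refine ⟨(LinearMap.pi fun b => Submodule.subtype _ ∘ₗ h b).codRestrict (P.total I m)
      fun y => (P.mem_total I).mpr fun b => (h b y).2, fun x => Subtype.ext (funext fun b => ?_)⟩
    exact hh b x

/-- The differential as a map to the cocycles. -/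
def toTotalCocycles (m : ℤ) : P.total I m →ₗ[R] P.totalCocycles I (m + 1) :=
  (P.totalDiff I ∘ₗ (P.total I m).subtype).codRestrict _ fun x =>
    ⟨P.totalDiff_mem I x.2, P.totalDiff_totalDiff I x.1⟩

lemma exact_toTotalCocycles (m : ℤ) :
    Function.Exact (Submodule.inclusion inf_le_left : P.totalCocycles I m →ₗ[R] P.total I m)
      (P.toTotalCocycles I m) := by
  intro x
  constructor
  · intro h
    exact ⟨⟨x.1, x.2, congrArg Subtype.val h⟩, rfl⟩
  · rintro ⟨y, rfl⟩
    exact Subtype.ext y.2.2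

/-- In positive degrees the total complex is exact, since `P` lives in degrees at least zero. -/
lemma toTotalCocycles_surjective {m : ℤ} (hm : 0 ≤ m) :
    Function.Surjective (P.toTotalCocycles I m) := by
  intro z
  obtain ⟨w, hw, p, hp, hz⟩ := P.exists_eq_totalDiff_add I z.2.1 fun b _ => congrFun z.2.2 b
  rw [add_sub_cancel_right] at hw
  refine ⟨⟨w, hw⟩, Subtype.ext (hz.trans ?_).symm⟩
  have : (fun b => I.ε (p b)) = 0 := funext fun b => by
    rw [hp b (by lia), map_zero]
    rfl
  rw [this, add_zero]
  rfl

/-- The cokernel of `toTotalCocycles` is the homology of `P`. -/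
lemma finiteInjDim_quotient_range {j : ℕ} {m : ℤ} (hm : m + 1 = -j)
    (hP : P.HomologyFiniteInjDim j) :
    FiniteInjDim (ModuleCat.of R
      (P.totalCocycles I (m + 1) ⧸ LinearMap.range (P.toTotalCocycles I m))) := by
  obtain ⟨N, h, hsurj, hker, hN⟩ := hP
  let θ : P.cycles j →ₗ[R] P.totalCocycles I (m + 1) :=
    { toFun := fun p => ⟨fun b => I.ε (p.1 b), by
        refine ⟨(P.mem_total I).mpr fun b => ?_, ?_⟩
        · by_cases hb : P.deg b = j
          · rw [hm, hb, neg_add_cancel]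
            exact I.ε_mem _
          · rw [p.2.1 b hb, map_zero]
            exact zero_mem _
        · have h1 : P.diff R p.1 = 0 := p.2.2
          change P.totalDiff I (fun b => I.ε (p.1 b)) = 0
          rw [totalDiff_ε, h1]
          funext b
          simp⟩
      map_add' := fun p q => Subtype.ext (funext fun b => map_add I.ε _ _)
      map_smul' := fun r p => Subtype.ext (funext fun b => map_smul I.ε _ _) }
  let π := (LinearMap.range (P.toTotalCocycles I m)).mkQ ∘ₗ θ
  have hθ : ∀ p b, (θ p).1 b = I.ε (p.1 b) := fun _ _ => rfl
  have hπ : Function.Surjective π := by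
    intro z
    obtain ⟨z, rfl⟩ := Submodule.mkQ_surjective _ z
    obtain ⟨w, hw, p, hp, hz⟩ := P.exists_eq_totalDiff_add I z.2.1 fun b _ => congrFun z.2.2 b
    rw [add_sub_cancel_right] at hw
    have hpc : p ∈ P.comp j := fun b hb => hp b (by rw [hm]; lia)
    have hpd : P.diff R p = 0 := by
      have h1 : P.totalDiff I z.1 = 0 := z.2.2
      rw [hz, map_add, totalDiff_totalDiff, zero_add, totalDiff_ε] at h1
      funext b
      exact I.ε_injective ((congrFun h1 b).trans (map_zero _).symm)
    refine ⟨⟨p, hpc, hpd⟩, ?_⟩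
    refine (Submodule.Quotient.eq _).mpr ⟨⟨-w, neg_mem hw⟩, Subtype.ext ?_⟩
    have h2 : (θ ⟨p, hpc, hpd⟩).1 = fun b => I.ε (p b) := rfl
    rw [AddSubgroupClass.coe_sub, h2, hz]
    change P.totalDiff I (-w) = _
    rw [map_neg]
    abel
  have hkerπ : ∀ p, π p = 0 ↔ h p = 0 := by
    intro p
    rw [hker]
    constructor
    · intro hp
      obtain ⟨⟨y, hy⟩, hyp⟩ := (Submodule.Quotient.mk_eq_zero _).mp hp
      have hyp' : P.totalDiff I y = fun b => I.ε (p.1 b) := congrArg Subtype.val hyp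
      obtain ⟨w, hw, q, hq, hyq⟩ := P.exists_eq_totalDiff_add I hy fun b hb => by
        rw [hyp']
        change I.ε (p.1 b) = 0
        rw [p.2.1 b (by lia), map_zero]
      refine ⟨q, fun b hb => hq b (by lia), ?_⟩
      rw [hyq, map_add, totalDiff_totalDiff, zero_add, totalDiff_ε] at hyp'
      funext b
      exact I.ε_injective (congrFun hyp' b)
    · rintro ⟨y, hy, hyp⟩
      refine (Submodule.Quotient.mk_eq_zero _).mpr ⟨⟨fun b => I.ε (y b),
        (P.mem_total I).mpr fun b => ?_⟩, Subtype.ext ?_⟩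
      · by_cases hb : P.deg b = j + 1
        · rw [show m + (P.deg b : ℤ) = 0 by lia]
          exact I.ε_mem _
        · rw [hy b hb, map_zero]
          exact zero_mem _
      · refine (P.totalDiff_ε I y).trans (funext fun b => ?_)
        rw [hyp]
        rfl
  have hkereq : LinearMap.ker h = LinearMap.ker π := by
    ext p
    exact (hkerπ p).symm
  exact FiniteInjDim.of_equiv (X := N) ((h.quotKerEquivOfSurjective hsurj).symm.trans
    ((Submodule.quotEquivOfEq _ _ hkereq).trans (π.quotKerEquivOfSurjective hπ))) hN

/-- Climbing the total complex from its lower end, all its cocycle modules are seen to have finite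
injective dimension when the homology of `P` does. -/
lemma finiteInjDim_totalCocycles (hP : ∀ j, P.HomologyFiniteInjDim j) :
    FiniteInjDim (ModuleCat.of R (P.totalCocycles I 0)) := by
  let N := Finset.univ.sup P.deg + 1
  suffices h : ∀ k : ℕ, k ≤ N → ∀ m : ℤ, m = k - N →
      FiniteInjDim (ModuleCat.of R (P.totalCocycles I m)) from h N le_rfl 0 (by lia)
  intro k
  induction k with
  | zero =>
    intro _ m hm
    have : Subsingleton (ModuleCat.of R (P.totalCocycles I m)) := by
      refine subsingleton_of_forall_eq (0 : P.totalCocycles I m) fun x =>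
        Subtype.ext (funext fun b => ?_)
      have := Finset.le_sup (f := P.deg) (Finset.mem_univ b)
      exact I.comp_neg (by lia) ((P.mem_total I).mp x.2.1 b)
    exact .of_subsingleton _
  | succ k ih =>
    intro hk m hm
    obtain ⟨m, rfl⟩ : ∃ m', m = m' + 1 := ⟨m - 1, by ring⟩
    have hZ := ih (by lia) m (by lia)
    have := P.injective_total I m
    obtain ⟨j, hj⟩ : ∃ j : ℕ, m + 1 = -j := ⟨(-(m + 1)).toNat, by lia⟩
    let T := P.toTotalCocycles I m
    have hrange : FiniteInjDim (ModuleCat.of R (LinearMap.range T)) :=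
      FiniteInjDim.right (A := ModuleCat.of R (P.totalCocycles I m))
        (B := ModuleCat.of R (P.total I m)) (g := T.rangeRestrict)
        (Submodule.inclusion_injective _)
        (fun x => Subtype.ext_iff.trans (P.exact_toTotalCocycles I m x))
        T.surjective_rangeRestrict hZ (.of_injective (ModuleCat.of R (P.total I m)))
    exact FiniteInjDim.mid (A := ModuleCat.of R (LinearMap.range T))
      (B := ModuleCat.of R (P.totalCocycles I (m + 1)))
      (C := ModuleCat.of R (_ ⧸ LinearMap.range T)) (f := (LinearMap.range T).subtype)
      (g := (LinearMap.range T).mkQ) (Submodule.injective_subtype _)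
      (LinearMap.exact_subtype_mkQ _) (Submodule.mkQ_surjective _) hrange
      (P.finiteInjDim_quotient_range I hj (hP j))

/-- Dimension shifting in the exact upper part of the total complex. -/
lemma ext_totalCocycles {n : ℕ} (hn : HasInjectiveDimensionLT
    (ModuleCat.of R (P.totalCocycles I 0)) n) (X : ModuleCat.{u} R) (m : ℕ) :
    ∀ i, 1 ≤ i → n ≤ i + m → Subsingleton (Ext X (ModuleCat.of R (P.totalCocycles I m)) i) := by
  induction m with
  | zero => exact fun i _ hi => HasInjectiveDimensionLT.subsingleton _ n i hi X
  | succ m ih =>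
    intro i hi him
    have := P.injective_total I m
    exact ext_covariant_right (A := ModuleCat.of R (P.totalCocycles I m))
      (B := ModuleCat.of R (P.total I m)) (C := ModuleCat.of R (P.totalCocycles I (m + 1)))
      (Submodule.inclusion_injective _) (P.exact_toTotalCocycles I m)
      (P.toTotalCocycles_surjective I (by lia))
      (ext_of_injective _ (ModuleCat.of R (P.total I m)) hi) (ih (i + 1) (by lia) (by lia))

end Total

/-- If all homology modules of a nonzero minimal complex have finite injective dimension, then the
ring is Gorenstein. On the socle of the total complex the differential of `P` vanishes, so the
socle complex is a direct sum of shifted copies of `Hom(k, I)`. It is exact in high degrees, since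
the cocycle modules eventually have no extensions by `k`, hence so is `Hom(k, I)`. -/
theorem isGorenstein_of_homologyFiniteInjDim [IsNoetherianRing R] [Nonempty P.B]
    (hP : ∀ j, P.HomologyFiniteInjDim j) : IsGorenstein R := by
  classical
  obtain ⟨I⟩ := exists_gradedInjectiveResolution R
  obtain ⟨n, hn⟩ := P.finiteInjDim_totalCocycles I hP
  obtain ⟨b⟩ := ‹Nonempty P.B›
  refine isGorenstein_of_socle_lift I (n + P.deg b) fun q hq s hs hδs hms => ?_
  obtain ⟨m, rfl⟩ : ∃ m, q = m + P.deg b := ⟨q - P.deg b, by lia⟩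
  have hext := P.ext_totalCocycles I hn (ModuleCat.of R (R ⧸ IsLocalRing.maximalIdeal R)) m 1
    le_rfl (by lia)
  let x : P.B → I.carrier := Pi.single b s
  have hxm : ∀ c, ∀ r ∈ IsLocalRing.maximalIdeal R, r • x c = 0 := by
    intro c r hr
    by_cases hc : c = b
    · subst hc
      simpa [x] using hms r hr
    · simp [x, hc]
  have hx : x ∈ P.totalCocycles I (m + 1) := by
    refine ⟨(P.mem_total I).mpr fun c => ?_, ?_⟩
    · by_cases hc : c = b
      · subst hc
        simpa [x, add_right_comm] using hs
      · simp [x, hc]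
    · change P.totalDiff I x = 0
      funext c
      rw [totalDiff_apply, P.diff_apply_eq_zero_of_socle hxm]
      by_cases hc : c = b
      · subst hc
        simp [x, hδs]
      · simp [x, hc]
  obtain ⟨φ, hφ⟩ := exists_linearMap_quotient (IsLocalRing.maximalIdeal R)
    (⟨x, hx⟩ : P.totalCocycles I (m + 1)) fun r hr => Subtype.ext (funext fun c => hxm c r hr)
  obtain ⟨ψ, hψ⟩ := exists_lift_of_ext_one (A := ModuleCat.of R (P.totalCocycles I m))
      (B := ModuleCat.of R (P.total I m)) (C := ModuleCat.of R (P.totalCocycles I (m + 1)))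
      (Submodule.inclusion_injective _) (P.exact_toTotalCocycles I m)
      (P.toTotalCocycles_surjective I (by lia)) hext φ
  let y : P.total I m := ψ (Submodule.mkQ _ 1)
  have hym : ∀ c, ∀ r ∈ IsLocalRing.maximalIdeal R, r • y.1 c = 0 := fun c r hr =>
    congrFun (congrArg Subtype.val (smul_apply_quotient_one _ ψ hr)) c
  have hy : P.totalDiff I y.1 = x := by
    have h1 := LinearMap.congr_fun hψ (Submodule.mkQ _ 1)
    exact congrArg Subtype.val (h1.trans hφ)
  refine ⟨(-1 : R) ^ P.deg b • y.1 b, ?_, fun r hr => ?_, ?_⟩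
  · have := (P.mem_total I).mp y.2 b
    rw [Nat.cast_add]
    exact Submodule.smul_mem _ _ this
  · rw [smul_comm, hym b r hr, smul_zero]
  · have h1 := congrFun hy b
    rw [totalDiff_apply, P.diff_apply_eq_zero_of_socle hym, Pi.zero_apply, add_zero] at h1
    rw [map_smul, h1]
    simp [x]

end MinimalComplex

end MinimalComplex

/-! ### Minimal models of modules -/

section MinimalModel

variable {R : Type u} [CommRing R] [IsLocalRing R]

namespace MinimalComplex

/-- A linear map `φ` from a minimal complex to `R^ι` that can be used to extend the complex by a
differential `P₀ → R^ι`: its entries lie in the maximal ideal, it vanishes in positive degrees and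
on boundaries. -/
structure IsMinimalAugmentation (P : MinimalComplex R) {ι : Type} (φ : (P.B → R) →ₗ[R] (ι → R)) :
    Prop where
  mem : ∀ p i, φ p i ∈ IsLocalRing.maximalIdeal R
  eq_zero : ∀ p, (∀ b, P.deg b = 0 → p b = 0) → φ p = 0
  diff : ∀ p, φ (P.diff R p) = 0

lemma map_eq_zero_of_mem_comp_succ (P : MinimalComplex R) {T : Type*} [AddCommGroup T] [Module R T]
    {ψ : (P.B → R) →ₗ[R] T} (hψ : ∀ p, (∀ b, P.deg b = 0 → p b = 0) → ψ p = 0)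
    {j : ℕ} {p : P.B → R} (hp : p ∈ P.comp (j + 1)) : ψ p = 0 :=
  hψ p fun b hb => hp b (by lia)

lemma diff_eq_zero_of_mem_comp_zero (P : MinimalComplex R) {p : P.B → R} (hp : p ∈ P.comp 0) :
    P.diff R p = 0 :=
  funext fun _ => P.diff_apply_eq_zero fun c hc => hp c (by lia)

lemma map_eq_sum_single {R : Type u} [CommRing R] {B : Type} [Fintype B] [DecidableEq B] {T : Type*}
    [AddCommGroup T] [Module R T] (φ : (B → R) →ₗ[R] T) (p : B → R) :
    φ p = ∑ c, p c • φ (Pi.single c 1) :=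
  (LinearMap.pi_apply_eq_sum_univ φ p).trans (Finset.sum_congr rfl fun c _ => by
    congr 2
    funext j
    simp [Pi.single_apply, eq_comm])

section Append

variable {P : MinimalComplex R} {ι : Type} [Fintype ι] {φ : (P.B → R) →ₗ[R] (ι → R)}
  (hφ : P.IsMinimalAugmentation φ)

open Classical in
/-- The complex `⋯ → P₁ → P₀ → R^ι → 0` obtained by shifting `P` up by one degree and appending
the linear map `φ : P₀ → R^ι`. -/
noncomputable def append : MinimalComplex R where
  B := ι ⊕ P.B
  deg := Sum.elim (fun _ => 0) (fun b => P.deg b + 1)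
  d x y := Sum.elim (fun _ => 0)
    (fun c => Sum.elim (fun i => φ (Pi.single c 1) i) (fun b => P.d b c) x) y
  deg_eq {x y} := by
    rcases x with i | b <;> rcases y with i' | c
    · simp
    · intro h
      by_contra hc
      refine h (congrFun (hφ.eq_zero (Pi.single c 1) fun b hb => ?_) i)
      refine Pi.single_eq_of_ne ?_ 1
      rintro rfl
      exact hc (by simp [hb])
    · simp
    · intro h
      exact congrArg (· + 1) (P.deg_eq h)
  d_mem x y := by
    rcases x with i | b <;> rcases y with i' | c
    · exact zero_mem _
    · exact hφ.mem _ _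
    · exact zero_mem _
    · exact P.d_mem b c
  d_d x y := by
    rcases x with i | b <;> rcases y with i' | e
    · simp
    · have h := congrFun (hφ.diff (Pi.single e 1)) i
      rw [map_eq_sum_single, Finset.sum_apply] at h
      simp only [Fintype.sum_sum_type, Sum.elim_inl, Sum.elim_inr, zero_mul,
        Finset.sum_const_zero, zero_add]
      rw [← h.trans (Pi.zero_apply i)]
      refine Finset.sum_congr rfl fun c _ => ?_
      simp [diff_apply, Pi.single_apply, mul_comm]
    · simp
    · simpa [Fintype.sum_sum_type] using P.d_d b e

/-- The coordinates in `R^ι`. -/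
def appendFst : ((append hφ).B → R) →ₗ[R] (ι → R) :=
  LinearMap.funLeft R R (Sum.inl : ι → ι ⊕ P.B)

/-- The coordinates in `P`. -/
def appendSnd : ((append hφ).B → R) →ₗ[R] (P.B → R) :=
  LinearMap.funLeft R R (Sum.inr : P.B → ι ⊕ P.B)

/-- The element with given coordinates in `R^ι` and in `P`. -/
def appendMk (u : ι → R) (p : P.B → R) : (append hφ).B → R := Sum.elim u p

lemma append_ext {x y : (append hφ).B → R} (h1 : appendFst hφ x = appendFst hφ y)
    (h2 : appendSnd hφ x = appendSnd hφ y) : x = y := by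
  funext b
  rcases b with i | b
  · exact congrFun h1 i
  · exact congrFun h2 b

lemma appendFst_diff (x : (append hφ).B → R) :
    appendFst hφ ((append hφ).diff R x) = φ (appendSnd hφ x) := by
  classical
  funext i
  refine ((append hφ).diff_apply x (Sum.inl i)).trans ((Fintype.sum_sum_type _).trans ?_)
  rw [map_eq_sum_single φ, Finset.sum_apply]
  simp only [append, Sum.elim_inl, Sum.elim_inr, zero_smul, Finset.sum_const_zero, zero_add]
  exact Finset.sum_congr rfl fun c _ => mul_comm _ _

lemma appendSnd_diff (x : (append hφ).B → R) :
    appendSnd hφ ((append hφ).diff R x) = P.diff R (appendSnd hφ x) := by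
  funext b
  refine ((append hφ).diff_apply x (Sum.inr b)).trans ((Fintype.sum_sum_type _).trans ?_)
  rw [diff_apply]
  simp [append, appendSnd]
  rfl

lemma mem_comp_append_zero {x : (append hφ).B → R} :
    x ∈ (append hφ).comp 0 ↔ appendSnd hφ x = 0 := by
  constructor
  · exact fun hx => funext fun b => hx (Sum.inr b) (Nat.succ_ne_zero _)
  · rintro h (i | b) hb
    · exact absurd rfl hb
    · exact congrFun h b

lemma mem_comp_append_succ {j : ℕ} {x : (append hφ).B → R} :
    x ∈ (append hφ).comp (j + 1) ↔ appendFst hφ x = 0 ∧ appendSnd hφ x ∈ P.comp j := by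
  constructor
  · intro hx
    exact ⟨funext fun i => hx (Sum.inl i) (Nat.succ_ne_zero j).symm,
      fun b hb => hx (Sum.inr b) fun h => hb (Nat.succ_injective h)⟩
  · rintro ⟨h1, h2⟩ (i | b) hb
    · exact congrFun h1 i
    · exact h2 b fun h => hb (congrArg (· + 1) h)

lemma appendMk_mem_comp {j : ℕ} {p : P.B → R} (hp : p ∈ P.comp j) :
    appendMk hφ 0 p ∈ (append hφ).comp (j + 1) :=
  (mem_comp_append_succ hφ).mpr ⟨rfl, hp⟩

lemma diff_appendMk_eq {p : P.B → R} {x : (append hφ).B → R}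
    (h1 : φ p = appendFst hφ x) (h2 : P.diff R p = appendSnd hφ x) (u : ι → R) :
    (append hφ).diff R (appendMk hφ u p) = x :=
  append_ext hφ ((appendFst_diff hφ _).trans h1) ((appendSnd_diff hφ _).trans h2)

lemma HomologyFiniteInjDim.append_succ {j : ℕ} (hP : P.HomologyFiniteInjDim (j + 1)) :
    (append hφ).HomologyFiniteInjDim (j + 2) := by
  obtain ⟨N, h, hsurj, hker, hN⟩ := hP
  let ρ : (append hφ).cycles (j + 2) →ₗ[R] P.cycles (j + 1) :=
    (appendSnd hφ ∘ₗ Submodule.subtype _).codRestrict _ fun x =>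
      ⟨((mem_comp_append_succ hφ).mp x.2.1).2, by
        have h1 : (append hφ).diff R x.1 = 0 := x.2.2
        exact (appendSnd_diff hφ x.1).symm.trans (by rw [h1, map_zero])⟩
  refine ⟨N, h ∘ₗ ρ, hsurj.comp fun z => ?_, fun x => (hker (ρ x)).trans ⟨?_, ?_⟩, hN⟩
  · have h1 : P.diff R z.1 = 0 := z.2.2
    exact ⟨⟨appendMk hφ 0 z.1, appendMk_mem_comp hφ z.2.1, diff_appendMk_eq hφ (x := 0)
      (P.map_eq_zero_of_mem_comp_succ hφ.eq_zero z.2.1) h1 0⟩, rfl⟩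
  · rintro ⟨y, hy, hyx⟩
    have hx := ((mem_comp_append_succ hφ).mp x.2.1).1
    exact ⟨appendMk hφ 0 y, appendMk_mem_comp hφ hy, diff_appendMk_eq hφ
      ((P.map_eq_zero_of_mem_comp_succ hφ.eq_zero hy).trans hx.symm) hyx 0⟩
  · rintro ⟨y, hy, hyx⟩
    refine ⟨appendSnd hφ y, ((mem_comp_append_succ hφ).mp hy).2, ?_⟩
    exact (appendSnd_diff hφ y).symm.trans (congrArg _ hyx)

end Append

end MinimalComplex

open MinimalComplex

/-- `X` is the cokernel `H₀` of a minimal complex whose homology in positive degrees has finite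
injective dimension. The augmentation `π` is defined on the whole complex, and vanishes in positive
degrees. -/
def HasMinimalModel (X : ModuleCat.{u} R) : Prop :=
  ∃ (P : MinimalComplex R) (π : (P.B → R) →ₗ[R] X),
    (∀ x, ∃ p ∈ P.comp 0, π p = x) ∧ (∀ p, (∀ b, P.deg b = 0 → p b = 0) → π p = 0) ∧
      (∀ p, π (P.diff R p) = 0) ∧ (∀ p ∈ P.comp 0, π p = 0 → ∃ y ∈ P.comp 1, P.diff R y = p) ∧
        ∀ j, P.HomologyFiniteInjDim (j + 1)

lemma HasMinimalModel.of_subsingleton (X : ModuleCat.{u} R) [Subsingleton X] :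
    HasMinimalModel X := by
  refine ⟨⟨Empty, Empty.elim, fun b => b.elim, fun {b} => b.elim, fun b => b.elim,
    fun b => b.elim⟩, 0, fun x => ⟨0, zero_mem _, Subsingleton.elim _ _⟩, fun _ _ => rfl,
    fun _ => rfl, fun p _ _ => ⟨0, zero_mem _, funext fun b => b.elim⟩, fun j =>
    ⟨ModuleCat.of R PUnit, 0, fun x => ⟨0, rfl⟩, fun z => ⟨fun _ => ⟨0, zero_mem _,
      funext fun b => b.elim⟩, fun _ => rfl⟩, .of_subsingleton _⟩⟩

/-- Yoneda splicing: a minimal model of `X` and a minimal presentation `X → R^ι → X' → 0`, with a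
kernel of finite injective dimension, make up a minimal model of `X'`. -/
lemma HasMinimalModel.splice {X X' : ModuleCat.{u} R} (hX : HasMinimalModel X) {ι : Type}
    [Fintype ι] {f : X →ₗ[R] (ι → R)} {q : (ι → R) →ₗ[R] X'}
    (hf : ∀ x i, f x i ∈ IsLocalRing.maximalIdeal R) (hfq : Function.Exact f q)
    (hq : Function.Surjective q) (hker : FiniteInjDim (ModuleCat.of R (LinearMap.ker f))) :
    HasMinimalModel X' := by
  obtain ⟨P, π, hsurj, hπ0, hπd, hexact, hH⟩ := hX
  have hφ : P.IsMinimalAugmentation (f ∘ₗ π) :=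
    ⟨fun p => hf (π p), fun p hp => (congrArg f (hπ0 p hp)).trans (map_zero f),
      fun p => (congrArg f (hπd p)).trans (map_zero f)⟩
  refine ⟨append hφ, q ∘ₗ appendFst hφ, fun x => ?_, fun x hx => ?_, fun x => ?_,
    fun x hx hqx => ?_, fun j => ?_⟩
  · obtain ⟨u, rfl⟩ := hq x
    exact ⟨appendMk hφ u 0, (mem_comp_append_zero hφ).mpr rfl, rfl⟩
  · have h1 : appendFst hφ x = 0 := funext fun i => hx (Sum.inl i) rfl
    rw [LinearMap.comp_apply, h1, map_zero]
  · rw [LinearMap.comp_apply, appendFst_diff]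
    exact (hfq _).mpr ⟨_, rfl⟩
  · obtain ⟨v, hv⟩ := (hfq _).mp hqx
    obtain ⟨p, hp, rfl⟩ := hsurj v
    exact ⟨appendMk hφ 0 p, appendMk_mem_comp hφ hp, diff_appendMk_eq hφ hv
      ((P.diff_eq_zero_of_mem_comp_zero hp).trans ((mem_comp_append_zero hφ).mp hx).symm) 0⟩
  · rcases j with - | j
    · -- The homology in degree one is the kernel of `f`.
      let h : (append hφ).cycles 1 →ₗ[R] LinearMap.ker f :=
        (π ∘ₗ appendSnd hφ ∘ₗ Submodule.subtype _).codRestrict _ fun x => by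
          have h1 : (append hφ).diff R x.1 = 0 := x.2.2
          exact (appendFst_diff hφ x.1).symm.trans (by rw [h1, map_zero])
      refine ⟨ModuleCat.of R (LinearMap.ker f), h, fun v => ?_, fun x => ⟨fun hx => ?_, ?_⟩, hker⟩
      · obtain ⟨p, hp, hpv⟩ := hsurj v.1
        have h1 : f v.1 = 0 := v.2
        exact ⟨⟨appendMk hφ 0 p, appendMk_mem_comp hφ hp, diff_appendMk_eq hφ (x := 0)
          ((congrArg f hpv).trans h1) (P.diff_eq_zero_of_mem_comp_zero hp) 0⟩, Subtype.ext hpv⟩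
      · have hxc := (mem_comp_append_succ hφ).mp x.2.1
        obtain ⟨y, hy, hyx⟩ := hexact _ hxc.2 (congrArg Subtype.val hx)
        refine ⟨appendMk hφ 0 y, appendMk_mem_comp hφ hy, diff_appendMk_eq hφ ?_ hyx 0⟩
        exact (congrArg f (P.map_eq_zero_of_mem_comp_succ hπ0 hy)).trans
          ((map_zero f).trans hxc.1.symm)
      · rintro ⟨y, -, hyx⟩
        refine Subtype.ext ?_
        have h1 : appendSnd hφ x.1 = P.diff R (appendSnd hφ y) := by
          rw [← hyx, appendSnd_diff]
        exact (congrArg π h1).trans (hπd _)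
    · exact (hH j).append_succ hφ

lemma HasMinimalModel.splice_of_injective {X X' : ModuleCat.{u} R} (hX : HasMinimalModel X)
    {ι : Type} [Fintype ι] {f : X →ₗ[R] (ι → R)} {q : (ι → R) →ₗ[R] X'}
    (hf : ∀ x i, f x i ∈ IsLocalRing.maximalIdeal R) (hinj : Function.Injective f)
    (hfq : Function.Exact f q) (hq : Function.Surjective q) : HasMinimalModel X' := by
  refine hX.splice hf hfq hq ?_
  have : Subsingleton (LinearMap.ker f) := by
    rw [LinearMap.ker_eq_bot.mpr hinj]
    infer_instance
  have : Subsingleton (ModuleCat.of R (LinearMap.ker f)) := this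
  exact .of_subsingleton _

/-- A nonzero module of finite injective dimension with a minimal model exists only over a
Gorenstein ring. -/
theorem HasMinimalModel.isGorenstein [IsNoetherianRing R] {X : ModuleCat.{u} R} [Nontrivial X]
    (hX : HasMinimalModel X) (hinj : FiniteInjDim X) : IsGorenstein R := by
  obtain ⟨P, π, hsurj, hπ0, hπd, hexact, hH⟩ := hX
  have : Nonempty P.B := by
    by_contra hB
    rw [not_nonempty_iff] at hB
    obtain ⟨x, hx⟩ := exists_ne (0 : X)
    obtain ⟨p, -, rfl⟩ := hsurj x
    exact hx (hπ0 p fun b => hB.elim b)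
  refine P.isGorenstein_of_homologyFiniteInjDim fun j => ?_
  rcases j with - | j
  · refine ⟨X, π ∘ₗ Submodule.subtype _, fun x => ?_, fun z => ⟨hexact z.1 z.2.1, ?_⟩, hinj⟩
    · obtain ⟨p, hp, hpx⟩ := hsurj x
      exact ⟨⟨p, hp, P.diff_eq_zero_of_mem_comp_zero hp⟩, hpx⟩
    · rintro ⟨y, -, hyz⟩
      exact (congrArg π hyz).symm.trans (hπd y)
  · exact hH j

/-- The minimal presentation of the power `X^b`, with kernel `(Ω X)^b`. -/
lemma exists_exact_pi_syzygy (X : ModuleCat.{u} R) [Module.Finite R X] (b : ℕ) :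
    ∃ (m : ℕ) (f : (Fin b → syzygy X) →ₗ[R] (Fin b × Fin m → R))
      (g : (Fin b × Fin m → R) →ₗ[R] (Fin b → X)),
      Function.Injective f ∧ Function.Exact f g ∧ Function.Surjective g ∧
        ∀ x i, f x i ∈ IsLocalRing.maximalIdeal R := by
  obtain ⟨m, f, g, hf, hfg, hg, hmin⟩ := exists_exact_syzygy X
  let e := LinearEquiv.curry R R (Fin b) (Fin m)
  refine ⟨m, e.symm.toLinearMap ∘ₗ f.compLeft (Fin b), g.compLeft (Fin b) ∘ₗ e.toLinearMap,
    e.symm.injective.comp fun x y h => funext fun i => hf (congrFun h i),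
    fun x => ⟨fun h => ?_, ?_⟩,
    fun y => ?_, fun x i => hmin _ _⟩
  · choose y hy using fun i => (hfg (e x i)).mp (congrFun h i)
    exact ⟨y, e.symm_apply_eq.mpr (funext hy)⟩
  · rintro ⟨y, rfl⟩
    exact funext fun i => (hfg _).mpr ⟨y i, rfl⟩
  · choose x hx using fun i => hg (y i)
    exact ⟨e.symm x, funext hx⟩

variable [IsNoetherianRing R]

/-- A minimal free resolution, which is finite, has no homology in positive degrees. -/
lemma HasMinimalModel.of_finiteProjDim {X : ModuleCat.{u} R} [hfin : Module.Finite R X]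
    (hX : FiniteProjDim X) : HasMinimalModel X := by
  obtain ⟨n, hn⟩ := hX
  replace hn : HasProjectiveDimensionLT X (n + 1) :=
    hasProjectiveDimensionLT_of_ge X n (n + 1) n.le_succ
  induction n generalizing X with
  | zero =>
    have : Projective X := projective_iff_hasProjectiveDimensionLT_one.mpr hn
    have : Module.Projective R X := (IsProjective.iff_projective X).mpr this
    have : Module.Free R X := Module.free_of_flat_of_isLocalRing
    let e := (Module.finBasis R X).equivFun.symm
    exact (HasMinimalModel.of_subsingleton (ModuleCat.of R PUnit)).splice_of_injective (f := 0)
      (q := e.toLinearMap) (fun _ _ => zero_mem _) (Function.injective_of_subsingleton _)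
      (fun x => by
        refine ⟨fun hx => ⟨0, (e.map_eq_zero_iff.mp hx).symm⟩, ?_⟩
        rintro ⟨y, rfl⟩
        exact map_zero e) e.surjective
  | succ n ih =>
    obtain ⟨m, f, g, hf, hfg, hg, hmin⟩ := exists_exact_syzygy X
    have hproj : Projective (ModuleCat.of R (Fin m → R)) :=
      (IsProjective.iff_projective _).mp inferInstance
    have h : HasProjectiveDimensionLT (syzygy X) (n + 1) :=
      ((shortExact_mk (B := ModuleCat.of R (Fin m → R)) hf hfg
        hg).hasProjectiveDimensionLT_X₃_iff n hproj).mp hn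
    exact (ih h).splice_of_injective hmin hf hfg hg

lemma exists_exact_pi_syzygyPow (X : ModuleCat.{u} R) [Module.Finite R X] (b n : ℕ) :
    ∃ (m : ℕ) (f : (Fin b → syzygyPow (n + 1) X) →ₗ[R] (Fin b × Fin m → R))
      (g : (Fin b × Fin m → R) →ₗ[R] (Fin b → syzygyPow n X)),
      Function.Injective f ∧ Function.Exact f g ∧ Function.Surjective g ∧
        ∀ x i, f x i ∈ IsLocalRing.maximalIdeal R := by
  rw [syzygyPow_succ]
  have := finite_syzygyPow n X
  exact exists_exact_pi_syzygy (syzygyPow n X) b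

/-- A minimal model of `(Ω^n X)^b` is continued by the last steps of the minimal free resolution of
`X^b`. -/
lemma HasMinimalModel.of_syzygyPow {X : ModuleCat.{u} R} [Module.Finite R X] {b n : ℕ}
    (h : HasMinimalModel (ModuleCat.of R (Fin b → syzygyPow n X))) :
    HasMinimalModel (ModuleCat.of R (Fin b → X)) := by
  induction n with
  | zero => exact h
  | succ n ih =>
    obtain ⟨m, f, g, hf, hfg, hg, hmin⟩ := exists_exact_pi_syzygyPow X b n
    exact ih (h.splice_of_injective (X' := ModuleCat.of R (Fin b → syzygyPow n X)) hmin hf hfg hg)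

/-- An exact sequence `0 → A → K → (Ω^n X)^b → 0` with `n ≥ 1`, in which `A` has finite injective
dimension and `K` has a minimal model, yields a minimal model of `X^b`: the map `K → (Ω^n X)^b`
is followed by the inclusion of `(Ω^n X)^b` into a minimal free module. -/
lemma HasMinimalModel.of_exact_syzygyPow {A K X : ModuleCat.{u} R} [Module.Finite R X] {b n : ℕ}
    (hn : 0 < n) {f : A →ₗ[R] K} {g : K →ₗ[R] (Fin b → syzygyPow n X)} (hf : Function.Injective f)
    (hfg : Function.Exact f g) (hg : Function.Surjective g) (hA : FiniteInjDim A)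
    (hK : HasMinimalModel K) : HasMinimalModel (ModuleCat.of R (Fin b → X)) := by
  obtain ⟨n, rfl⟩ := Nat.exists_eq_add_of_le' hn
  obtain ⟨m, f', g', hf', hfg', hg', hmin⟩ := exists_exact_pi_syzygyPow X b n
  have hker : LinearMap.ker (f' ∘ₗ g) = LinearMap.range f := by
    rw [LinearMap.ker_comp_of_ker_eq_bot _ (LinearMap.ker_eq_bot.mpr hf')]
    exact hfg.linearMap_ker_eq
  refine HasMinimalModel.of_syzygyPow (n := n) (hK.splice (f := f' ∘ₗ g) (q := g')
    (X' := ModuleCat.of R (Fin b → syzygyPow n X)) (fun x => hmin (g x)) (fun y => ?_) hg' ?_)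
  · refine (hfg' y).trans ⟨?_, ?_⟩
    · rintro ⟨z, rfl⟩
      obtain ⟨x, rfl⟩ := hg z
      exact ⟨x, rfl⟩
    · rintro ⟨x, rfl⟩
      exact ⟨g x, rfl⟩
  · exact hA.of_equiv ((LinearEquiv.ofInjective f hf).trans (LinearEquiv.ofEq _ _ hker.symm))

/-- The case of a reducing sequence of length zero or one. -/
lemma IsReducingSequence.isGorenstein_of_le_one {M : ModuleCat.{u} R} [Nontrivial M]
    (hM : FiniteInjDim M) {r : ℕ} (hr : r ≤ 1) {K : Fin (r + 1) → ModuleCat.{u} R}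
    (hK : IsReducingSequence (fun N : ModuleCat.{u} R => projectiveDimension N) M r K) :
    IsGorenstein R := by
  have hfin := hK.finite
  have hlast := HasMinimalModel.of_finiteProjDim (projectiveDimension_lt_top_iff.mp hK.last)
  obtain rfl | rfl : r = 0 ∨ r = 1 := by lia
  · have h0 : K (Fin.last 0) = M := hK.zero
    rw [h0] at hlast
    exact hlast.isGorenstein hM
  · have h0 : K (Fin.castSucc 0) = M := hK.zero
    obtain ⟨a, b, n, -, hb, hn, f, g, hf, hfg, hg⟩ := hK.step 0
    have hmodel := HasMinimalModel.of_exact_syzygyPow (A := ModuleCat.of R (Fin a → _)) hn hf hfg hg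
      (FiniteInjDim.pi (by rwa [h0]) a) hlast
    rw [h0] at hmodel
    have : Nonempty (Fin b) := ⟨⟨0, hb⟩⟩
    have : Nontrivial (ModuleCat.of R (Fin b → M)) := inferInstanceAs (Nontrivial (Fin b → M))
    exact hmodel.isGorenstein (hM.pi b)

/-- The case of depth at least `dim R - 1`: the module is a direct summand of a module of finite
projective dimension. -/
lemma IsReducingSequence.isGorenstein_of_le_depth {d : ℕ} (hd : ringKrullDim R = d)
    {M : ModuleCat.{u} R} [Nontrivial M] [Module.Finite R M] (hM : FiniteInjDim M)
    (hdepth : (d : ℕ∞) ≤ depth R M + 1) {r : ℕ} {K : Fin (r + 1) → ModuleCat.{u} R}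
    (hK : IsReducingSequence (fun N : ModuleCat.{u} R => projectiveDimension N) M r K) :
    IsGorenstein R := by
  obtain ⟨s, p, hsp⟩ := hK.exists_retract (ext_self_of_le_depth hd hM hdepth) (Fin.last r)
  exact (HasMinimalModel.of_finiteProjDim ((projectiveDimension_lt_top_iff.mp hK.last).of_retract
    s p hsp)).isGorenstein hM

end MinimalModel

end ReducingDimension

theorem theorem1p2 {R : Type u} [CommRing R] [IsLocalRing R] [IsNoetherianRing R]
    (d : ℕ) (hd : ringKrullDim R = d)
    (M : Type u) [AddCommGroup M] [Module R M] [Module.Finite R M] [Nontrivial M]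
    (hM : CategoryTheory.injectiveDimension (ModuleCat.of R M) < ⊤) :
    ReducingDimension.reducingGDim (ModuleCat.of R M) =
        ReducingDimension.reducingProjDim (ModuleCat.of R M) ∧
      ((ReducingDimension.reducingGDim (ModuleCat.of R M) ≤ 1 ∨
          (ReducingDimension.reducingGDim (ModuleCat.of R M) < ⊤ ∧
            (d : ℕ∞) ≤ ReducingDimension.depth R M + 1)) →
        ReducingDimension.IsGorenstein R) := by
  have hM' := ReducingDimension.injectiveDimension_lt_top_iff.mp hM
  have hi := ReducingDimension.reducingGDim_eq_reducingProjDim hM'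
  refine ⟨hi, ?_⟩
  rw [hi]
  simp only [ReducingDimension.reducingProjDim, ReducingDimension.reducingDim]
  rintro (h | ⟨h, hdepth⟩)
  · -- An infimum of natural numbers that is at most one is attained at some `r ≤ 1`.
    have h2 := h.trans_lt (show (1 : ℕ∞) < 2 by norm_num)
    simp only [iInf_lt_iff] at h2
    obtain ⟨r, ⟨K, hK⟩, hr⟩ := h2
    have hr' : r < 2 := by exact_mod_cast hr
    exact hK.isGorenstein_of_le_one hM' (by lia)
  · simp only [iInf_lt_iff] at h
    obtain ⟨r, ⟨K, hK⟩, -⟩ := h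
    exact hK.isGorenstein_of_le_depth hd hM' hdepth
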